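/- **Notation.** Let $U\subset\mathbb R^n$ be an open neighborhood of the origin and $f\in C^\infty(U)$, with Taylor coefficients $c_\alpha=\partial^\alpha f(0)/\alpha!$. The Newton polyhedron $\Gamma_+(f)$ is the convex hull of $\bigcup\{\alpha+\mathbb R_+^n: c_\alpha\ne 0\}$, and $f$ is nonflat if $\Gamma_+(f)\neq\emptyset$. A face of a set $P\subset\mathbb R^n$ is a set $P\cap\{x:\langle a,x\rangle=l\}$, where $(a,l)\in\mathbb Z^n\times\mathbb Z$ satisfies $\langle a,x\rangle\ge l$ on $P$; we say that the pair $(a,l)$ defines this face. For a face $\gamma$ of $\Gamma_+(f)$, $f$ admits the $\gamma$-part on $W$ if $\lim_{t\to0}f(t^{a_1}x_1,\dots,t^{a_n}x_n)/t^l$ exists for all $x\in W$ and all pairs $(a,l)\in\mathbb Z_+^n\times\mathbb Z_+$ defining $\gamma$; the common value of the limits is $f_\gamma(x)$. A nonflat $f$ belongs to $\hat{\mathcal E}(U)$ if for every face $\gamma$ of $\Gamma_+(f)$ it admits the $\gamma$-part on some open neighborhood of the origin contained in $U$ (the only flat element of $\hat{\mathcal E}(U)$ is $0$). For a nonempty compact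 face $\gamma$ of $\Gamma_+(f)$, $f_\gamma$ is defined on all of $\mathbb R^n$ (it is a polynomial); $f$ is nondegenerate over $\mathbb R$ with respect to $\Gamma_+(f)$ if, for every such $\gamma$, $\nabla f_\gamma$ has no zero in $(\mathbb R\setminus\{0\})^n$. Put $l_f(a)=\min\{\langle a,\alpha\rangle:\alpha\in\Gamma_+(f)\}$ for $a\in\mathbb Z_+^n$. The fan associated with $P=\Gamma_+(f)\ne\emptyset$ consists of the closures of the sets $\gamma^\vee$ of all $a\in\mathbb R_+^n$ for which $\langle a,\cdot\rangle$ attains its minimum over $P$ exactly on $\gamma$, where $\gamma$ runs over the nonempty faces of $P$; the fan associated with $P_1,\dots,P_m$ consists of the intersections $\sigma_1\cap\dots\cap\sigma_m$ with $\sigma_k$ in the fan associated with $P_k$. The skeleton of a cone is the set of primitive integer vectors in its edges. A simplicial (unimodular) subdivision of a fan $\Sigma_0$ is a fan $\Sigma$ with the same support such that each cone of $\Sigma$ lies in a cone of $\Sigma_0$ and the skeleton of each cone of $\Sigma$ can be completed to a basis of $\mathbb Z^n$. For an $n$-dimensional cone $\sigma\in\Sigma$ with skeleton $a^1(\sigma),\dots,a^n(\sigma)\in\mathbb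 Z_+^n$ (ordered), define $\pi(\sigma):\mathbb R^n\to\mathbb R^n$ by $\pi(\sigma)(y)=x$, $x_j=\prod_{k=1}^n y_k^{a^k_j(\sigma)}$. For $I\subset\{1,\dots,n\}$ let $\tilde T_I=\{y\in\mathbb R^n: y_j=0\text{ if and only if }j\in I\}$. **Theorem 7.2.** Let $f_1,\dots,f_m\in\hat{\mathcal E}(U)$ be nonflat with $f_k(0)=0$ and $\nabla f_k(0)=0$ for all $k$. Then there is an open neighborhood $V\subset U$ of the origin, and one may take $V=U$ if every $f_k$ admits the $\gamma$-part on $U$ itself for every face $\gamma$ of $\Gamma_+(f_k)$, such that the following holds for every simplicial subdivision $\Sigma$ of the fan associated with $\Gamma_+(f_1),\dots,\Gamma_+(f_m)$, every $n$-dimensional cone $\sigma\in\Sigma$ and every $k\in\{1,\dots,m\}$. The minima $l_{f_k}(a^j(\sigma))$ exist and are nonnegative integers, $0\in\pi(\sigma)^{-1}(V)$, and there is a smooth function $f_{k,\sigma}$ on $\pi(\sigma)^{-1}(V)$ with $f_{k,\sigma}(0)\ne0$ and $$f_k(\pi(\sigma)(y))=\Bigl(\prod_{j=1}^n y_j^{\,l_{f_k}(a^j(\sigma))}\Bigr)f_{k,\sigma}(y)\qquad\text{for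 } y\in\pi(\sigma)^{-1}(V).$$ Furthermore, if $f_k$ is nondegenerate over $\mathbb R$ with respect to $\Gamma_+(f_k)$ and $I\subset\{1,\dots,n\}$ satisfies $\pi(\sigma)(\tilde T_I)=\{0\}$, then the set $\{y\in\tilde T_I:f_{k,\sigma}(y)=0\}$ is nonsingular, i.e. the gradient of the restriction of $f_{k,\sigma}$ to $\tilde T_I$ does not vanish at any point of this set. -/

import Mathlib

open Set Filter Topology
open scoped ContDiff

noncomputable section

namespace NewtonToric

/-! ### Rational polyhedral geometry in `ℝⁿ` -/

/-- The hyperplane `H(a,l) = {x : ⟨a,x⟩ = l}`. -/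
def hyperplane {n : ℕ} (a : Fin n → ℝ) (l : ℝ) : Set (Fin n → ℝ) :=
  {x | a ⬝ᵥ x = l}

/-- `(a,l)` is valid for `P`: the set `P` lies in the half-space `{x : ⟨a,x⟩ ≥ l}`. -/
def IsValid {n : ℕ} (P : Set (Fin n → ℝ)) (a : Fin n → ℝ) (l : ℝ) : Prop :=
  ∀ x ∈ P, l ≤ a ⬝ᵥ x

/-- A face of `P` is a set `P ∩ H(a,l)` with a valid pair `(a,l) ∈ ℤⁿ × ℤ`.
(`P` itself and the empty set are faces.) -/
def IsFace {n : ℕ} (P F : Set (Fin n → ℝ)) : Prop :=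
  ∃ (a : Fin n → ℤ) (l : ℤ),
    IsValid P (fun i => (a i : ℝ)) l ∧ F = P ∩ hyperplane (fun i => (a i : ℝ)) l

/-- The dimension of the affine hull (of a nonempty set). -/
def dim {n : ℕ} (F : Set (Fin n → ℝ)) : ℕ :=
  Module.finrank ℝ (vectorSpan ℝ F)

/-! ### Cones, fans, simplicial (unimodular) subdivisions -/

/-- A cone generated by finitely many integer vectors. -/
def IsRationalCone {n : ℕ} (σ : Set (Fin n → ℝ)) : Prop :=
  ∃ (k : ℕ) (u : Fin k → Fin n → ℤ),
    σ = {x | ∃ c : Fin k → ℝ, (∀ i, 0 ≤ c i) ∧ ∀ j, x j = ∑ i, c i * (u i j : ℝ)}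

/-- `σ ∩ (-σ) = {0}`. -/
def IsStronglyConvex {n : ℕ} (σ : Set (Fin n → ℝ)) : Prop :=
  {x | x ∈ σ ∧ -x ∈ σ} = {0}

/-- A fan in `ℝⁿ`. As usual, only nonempty faces of cones are counted in the second condition. -/
structure IsFan {n : ℕ} (S : Set (Set (Fin n → ℝ))) : Prop where
  finite : S.Finite
  rational : ∀ σ ∈ S, IsRationalCone σ
  stronglyConvex : ∀ σ ∈ S, IsStronglyConvex σ
  face_mem : ∀ σ ∈ S, ∀ τ, IsFace σ τ → τ.Nonempty → τ ∈ S
  inter_face : ∀ σ ∈ S, ∀ τ ∈ S, IsFace σ (σ ∩ τ) ∧ IsFace τ (σ ∩ τ)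

/-- The skeleton of a cone: the primitive integer vectors in its edges. -/
def skeleton {n : ℕ} (σ : Set (Fin n → ℝ)) : Set (Fin n → ℤ) :=
  {v | Finset.univ.gcd v = 1 ∧
    ∃ e, IsFace σ e ∧ dim e = 1 ∧ (fun i => (v i : ℝ)) ∈ e}

/-- `S` is a simplicial (unimodular) subdivision of `S₀`: a fan with the same support, each of
whose cones lies in a cone of `S₀` and has a skeleton that can be completed to a basis of the
lattice `ℤⁿ`. -/
structure IsSimplicialSubdivision {n : ℕ} (S S₀ : Set (Set (Fin n → ℝ))) : Prop where
  isFan : IsFan S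
  support_eq : ⋃₀ S = ⋃₀ S₀
  subset_cone : ∀ σ ∈ S, ∃ τ ∈ S₀, σ ⊆ τ
  unimodular : ∀ σ ∈ S, ∃ b : Module.Basis (Fin n) ℤ (Fin n → ℤ), skeleton σ ⊆ Set.range b

/-! ### The fan associated with polyhedra -/

/-- The face `γ(a)` of `P`: the points where `⟨a,·⟩` attains its minimum `l(a)` over `P`. -/
def minFace {n : ℕ} (P : Set (Fin n → ℝ)) (a : Fin n → ℝ) : Set (Fin n → ℝ) :=
  {x | x ∈ P ∧ ∀ z ∈ P, a ⬝ᵥ x ≤ a ⬝ᵥ z}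

/-- `γ^∨ = {a : γ(a) = γ and a_j ≥ 0 for all j}`. -/
def dualCone {n : ℕ} (P γ : Set (Fin n → ℝ)) : Set (Fin n → ℝ) :=
  {a | (∀ j, 0 ≤ a j) ∧ minFace P a = γ}

/-- The fan associated with `P`: the closures of `γ^∨`, for the nonempty faces `γ` of `P`. -/
def fanOf {n : ℕ} (P : Set (Fin n → ℝ)) : Set (Set (Fin n → ℝ)) :=
  {σ | ∃ γ, IsFace P γ ∧ γ.Nonempty ∧ σ = closure (dualCone P γ)}

/-- The fan associated with `P₁,…,P_m`: the intersections `σ₁ ∩ ⋯ ∩ σ_m`, with `σ_k` in the fan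
associated with `P_k`. -/
def jointFan {n m : ℕ} (P : Fin m → Set (Fin n → ℝ)) : Set (Set (Fin n → ℝ)) :=
  {σ | ∃ τ : Fin m → Set (Fin n → ℝ), (∀ k, τ k ∈ fanOf (P k)) ∧ σ = ⋂ k, τ k}

/-! ### Taylor coefficients and Newton polyhedra -/

/-- The partial derivative `∂f/∂x_i`. -/
def partialDeriv {n : ℕ} (i : Fin n) (f : (Fin n → ℝ) → ℝ) : (Fin n → ℝ) → ℝ :=
  fun x => fderiv ℝ f x (Pi.single i 1)

/-- `∂^α f = (∂/∂x₁)^{α₁} ⋯ (∂/∂x_n)^{α_n} f`. -/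
def mixedPartial {n : ℕ} (α : Fin n → ℕ) (f : (Fin n → ℝ) → ℝ) : (Fin n → ℝ) → ℝ :=
  (List.finRange n).foldr (fun i g => (partialDeriv i)^[α i] g) f

/-- The Taylor coefficient `c_α = ∂^α f(0) / α!` at the origin. -/
def taylorCoeff {n : ℕ} (f : (Fin n → ℝ) → ℝ) (α : Fin n → ℕ) : ℝ :=
  mixedPartial α f 0 / ∏ i, ((α i).factorial : ℝ)

/-- The Newton polyhedron `Γ₊(f)`: the convex hull of the union of the sets `α + ℝ₊ⁿ`, `c_α ≠ 0`. -/
def newtonPolyhedron {n : ℕ} (f : (Fin n → ℝ) → ℝ) : Set (Fin n → ℝ) :=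
  convexHull ℝ {x | ∃ α : Fin n → ℕ, taylorCoeff f α ≠ 0 ∧ ∀ i, (α i : ℝ) ≤ x i}

/-- `f` is flat if its Newton polyhedron is empty. -/
def IsFlat {n : ℕ} (f : (Fin n → ℝ) → ℝ) : Prop :=
  newtonPolyhedron f = ∅

/-! ### `γ`-parts and the class `Ê(U)` -/

/-- `f(t^{a₁}x₁,…,t^{a_n}x_n) / t^l`. -/
def scaledQuotient {n : ℕ} (f : (Fin n → ℝ) → ℝ) (a : Fin n → ℕ) (l : ℕ)
    (x : Fin n → ℝ) (t : ℝ) : ℝ :=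
  f (fun i => t ^ a i * x i) / t ^ l

/-- `(a,l) ∈ ℤ₊ⁿ × ℤ₊` is a valid pair for `P` that defines the face `γ`. -/
def DefinesFace {n : ℕ} (P γ : Set (Fin n → ℝ)) (a : Fin n → ℕ) (l : ℕ) : Prop :=
  IsValid P (fun i => (a i : ℝ)) l ∧ γ = P ∩ hyperplane (fun i => (a i : ℝ)) l

/-- `f` admits the `γ`-part on `W`, where `γ` is a face of `P`. -/
def AdmitsPart {n : ℕ} (f : (Fin n → ℝ) → ℝ) (P γ W : Set (Fin n → ℝ)) : Prop :=
  ∀ (a : Fin n → ℕ) (l : ℕ), DefinesFace P γ a l →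
    ∀ x ∈ W, ∃ c : ℝ, Tendsto (scaledQuotient f a l x) (𝓝[≠] 0) (𝓝 c)

/-- `g` is the `γ`-part of `f` on `W`: the common value of the limits for all valid pairs in
`ℤ₊ⁿ × ℤ₊` that define `γ`. -/
def IsPart {n : ℕ} (f : (Fin n → ℝ) → ℝ) (P γ W : Set (Fin n → ℝ))
    (g : (Fin n → ℝ) → ℝ) : Prop :=
  ∀ (a : Fin n → ℕ) (l : ℕ), DefinesFace P γ a l →
    ∀ x ∈ W, Tendsto (scaledQuotient f a l x) (𝓝[≠] 0) (𝓝 (g x))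

/-- The class `Ê[P](U)`. -/
structure MemEHatOf {n : ℕ} (P U : Set (Fin n → ℝ)) (f : (Fin n → ℝ) → ℝ) : Prop where
  smooth : ContDiffOn ℝ ∞ f U
  newton_subset : newtonPolyhedron f ⊆ P
  admits : P.Nonempty → ∀ γ, IsFace P γ →
    ∃ W, IsOpen W ∧ (0 : Fin n → ℝ) ∈ W ∧ W ⊆ U ∧ AdmitsPart f P γ W
  eq_zero : P = ∅ → ∀ x ∈ U, f x = 0

/-- The class `Ê(U)`. -/
def MemEHat {n : ℕ} (U : Set (Fin n → ℝ)) (f : (Fin n → ℝ) → ℝ) : Prop :=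
  MemEHatOf (newtonPolyhedron f) U f

/-- `f` is nondegenerate over `ℝ` with respect to `Γ₊(f)`: for every (nonempty) compact face `γ`,
the gradient of the `γ`-part has no zero in `(ℝ ∖ {0})ⁿ`. For a compact face and `f` smooth near
the origin the defining limits exist at every point of `ℝⁿ` and do not depend on the valid pair,
so there is exactly one `g` below. -/
def IsNondegenerate {n : ℕ} (f : (Fin n → ℝ) → ℝ) : Prop :=
  ∀ γ, IsFace (newtonPolyhedron f) γ → γ.Nonempty → IsCompact γ →
    ∀ g, IsPart f (newtonPolyhedron f) γ univ g →
      ∀ x : Fin n → ℝ, (∀ i, x i ≠ 0) → ∃ i, partialDeriv i g x ≠ 0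

/-! ### Toric charts -/

/-- The chart map `π(σ)(y) = x`, `x_j = ∏_k y_k^{a^k_j}`, for a cone with skeleton `a¹,…,aⁿ`. -/
def chart {n : ℕ} (a : Fin n → Fin n → ℕ) (y : Fin n → ℝ) : Fin n → ℝ :=
  fun j => ∏ k, y k ^ a k j

/-- The stratum `{y : y_j = 0 if and only if j ∈ I}`. -/
def stratum {n : ℕ} (I : Set (Fin n)) : Set (Fin n → ℝ) :=
  {y | ∀ j, y j = 0 ↔ j ∈ I}

end NewtonToric

end

noncomputable section

namespace NewtonToric

/-! ### Integrals depending smoothly on parameters, and division by a coordinate -/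

/-! Multiplying the chart coordinate `y_j` by `t` scales `x = π(y)` by the weights `t^{a^j}`. A
limit of `f(t^{a^j} x) / t^{l_j}` therefore says that `f ∘ π` vanishes to order `l_j` along `y_j =
0`, and Hadamard division removes these factors one at a time (`exists_smooth_quotient`). The
exponents `l_j` come from convexity: as `σ` lies in one cone of the fan, a single exponent `α` with
`c_α ≠ 0` minimizes every `⟨a^j, ·⟩` (`exists_common_exponent`), so `l_j = ⟨a^j, α⟩`. One
neighborhood `V` serves all subdivisions because only finitely many faces are involved
(`finite_definesFace`).

Write `g` for the quotient. On `{y_j = 0, j ∈ I}` it is, up to a monomial, a quasihomogeneous part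
of `f` composed with `π` (`weightPart_chart`), provided the weight `∑_{j ∈ I} a^j` is positive. With
all indices in `I`, independence of the `a^j` leaves the single term `c_α`, so `g(0) = c_α ≠ 0`. If
`π` sends the stratum of `I` to the origin, the weight is positive and its face `γ` compact. Since
`π` is a local diffeomorphism off the coordinate hyperplanes, a singular zero of `g` on the stratum
would give a zero of `∇f_γ` with nonzero coordinates. -/

theorem hasFDerivAt_integral_of_contDiff {E F : Type*} [NormedAddCommGroup E] [NormedSpace ℝ E]
    [FiniteDimensional ℝ E] [NormedAddCommGroup F] [NormedSpace ℝ F]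
    {Φ : ℝ × E → F} (hΦ : ContDiff ℝ ∞ Φ) (x₀ : E) :
    HasFDerivAt (fun x => ∫ s in (0 : ℝ)..1, Φ (s, x))
      (∫ s in (0 : ℝ)..1, (fderiv ℝ Φ (s, x₀)).comp (ContinuousLinearMap.inr ℝ ℝ E)) x₀ := by
  have hd : Continuous fun p : ℝ × E => (fderiv ℝ Φ p).comp (ContinuousLinearMap.inr ℝ ℝ E) :=
    (hΦ.continuous_fderiv (by simp)).clm_comp continuous_const
  obtain ⟨C, hC⟩ := ((isCompact_Icc (a := (0 : ℝ)) (b := 1)).prod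
    (isCompact_closedBall x₀ 1)).exists_bound_of_continuousOn hd.continuousOn
  refine intervalIntegral.hasFDerivAt_integral_of_dominated_of_fderiv_le
    (F := fun x s => Φ (s, x))
    (F' := fun x s => (fderiv ℝ Φ (s, x)).comp (ContinuousLinearMap.inr ℝ ℝ E))
    (bound := fun _ => C) (Metric.closedBall_mem_nhds x₀ one_pos) ?_ ?_ ?_ ?_ ?_ ?_
  · exact Eventually.of_forall fun x =>
      (hΦ.continuous.comp (by fun_prop : Continuous fun s : ℝ => (s, x))).aestronglyMeasurable
  · exact (hΦ.continuous.comp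
      (by fun_prop : Continuous fun s : ℝ => (s, x₀))).intervalIntegrable _ _
  · exact (hd.comp (by fun_prop : Continuous fun s : ℝ => (s, x₀))).aestronglyMeasurable
  · refine Eventually.of_forall fun t ht x hx => hC (t, x) ⟨?_, hx⟩
    rw [uIoc_of_le zero_le_one] at ht
    exact ⟨ht.1.le, ht.2⟩
  · exact intervalIntegrable_const
  · refine Eventually.of_forall fun t _ x _ => ?_
    exact ((hΦ.differentiable (by simp)) (t, x)).hasFDerivAt.comp x (hasFDerivAt_prodMk_right t x)

theorem contDiff_integral_of_contDiff {E F : Type} [NormedAddCommGroup E] [NormedSpace ℝ E]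
    [FiniteDimensional ℝ E] [NormedAddCommGroup F] [NormedSpace ℝ F]
    {Φ : ℝ × E → F} (hΦ : ContDiff ℝ ∞ Φ) :
    ContDiff ℝ ∞ fun x => ∫ s in (0 : ℝ)..1, Φ (s, x) := by
  rw [contDiff_infty]
  intro k
  -- The derivative is an integral of the same kind with values in `E →L[ℝ] F`, so `F` must vary;
  -- keeping `E` and `F` in `Type` keeps that space in the same universe.
  induction k generalizing F with
  | zero =>
    refine contDiff_zero.2 (continuous_iff_continuousAt.2 fun x => ?_)
    exact (hasFDerivAt_integral_of_contDiff hΦ x).continuousAt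
  | succ k ih =>
    refine contDiff_succ_iff_hasFDerivAt.2
      ⟨_, ?_, fun x => hasFDerivAt_integral_of_contDiff hΦ x⟩
    exact ih (Φ := fun p => (fderiv ℝ Φ p).comp (ContinuousLinearMap.inr ℝ ℝ E))
      ((hΦ.fderiv_right (by simp)).clm_comp contDiff_const)

/-- Reduces local statements to functions smooth on all of `ℝⁿ`, for which integrals along segments
make sense without any condition on the shape of `O`. -/
theorem exists_cutoff {n : ℕ} {O : Set (Fin n → ℝ)} (hO : IsOpen O) {x₀ : Fin n → ℝ}
    (hx₀ : x₀ ∈ O) :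
    ∃ χ : (Fin n → ℝ) → ℝ, χ =ᶠ[𝓝 x₀] 1 ∧ (∀ x ∉ O, χ x = 0) ∧
      ∀ G : (Fin n → ℝ) → ℝ, ContDiffOn ℝ ∞ G O → ContDiff ℝ ∞ fun x => χ x * G x := by
  obtain ⟨r, hr, hball⟩ := Metric.isOpen_iff.1 hO x₀ hx₀
  let χ : ContDiffBump x₀ := ⟨r / 4, r / 2, by positivity, by linarith⟩
  have hsub : tsupport χ ⊆ O := by
    rw [χ.tsupport_eq]
    exact (Metric.closedBall_subset_ball (by change r / 2 < r; linarith)).trans hball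
  refine ⟨χ, χ.eventuallyEq_one, fun x hx => image_eq_zero_of_notMem_tsupport
    fun h => hx (hsub h), fun G hG => contDiff_iff_contDiffAt.2 fun x => ?_⟩
  by_cases hx : x ∈ tsupport χ
  · exact χ.contDiffAt.mul (hG.contDiffAt (hO.mem_nhds (hsub hx)))
  · refine (contDiffAt_const (c := (0 : ℝ))).congr_of_eventuallyEq ?_
    filter_upwards [(isClosed_tsupport χ).isOpen_compl.mem_nhds hx] with z hz
    simp [image_eq_zero_of_notMem_tsupport hz]

/-- A smooth function on `ℝⁿ` vanishing on `{y_j = 0}` is smoothly divisible by `y_j`. -/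
theorem exists_eq_coord_mul_of_contDiff {n : ℕ} (j : Fin n) {G : (Fin n → ℝ) → ℝ}
    (hG : ContDiff ℝ ∞ G) (h0 : ∀ y, y j = 0 → G y = 0) :
    ∃ H : (Fin n → ℝ) → ℝ, ContDiff ℝ ∞ H ∧ ∀ y, G y = y j * H y := by
  -- The segment runs from `y` with its `j`-th coordinate set to 0, at `s = 0`, to `y` itself, at `s
  -- = 1`; the quotient is the mean of `∂_j G` along it.
  have hline : ContDiff ℝ ∞ fun p : ℝ × (Fin n → ℝ) =>
      p.2 + ((p.1 - 1) * p.2 j) • (Pi.single j 1 : Fin n → ℝ) := by fun_prop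
  have hG' : ContDiff ℝ ∞ (partialDeriv j G) :=
    (hG.fderiv_right (by simp)).clm_apply contDiff_const
  have hΦ := hG'.comp hline
  refine ⟨_, contDiff_integral_of_contDiff hΦ, fun y => ?_⟩
  have hder : ∀ s : ℝ, HasDerivAt
      (fun s : ℝ => G (y + ((s - 1) * y j) • (Pi.single j 1 : Fin n → ℝ)))
      (y j * partialDeriv j G (y + ((s - 1) * y j) • (Pi.single j 1 : Fin n → ℝ))) s := by
    intro s
    have h1 : HasDerivAt (fun s : ℝ => y + ((s - 1) * y j) • (Pi.single j 1 : Fin n → ℝ))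
        ((y j) • (Pi.single j 1 : Fin n → ℝ)) s := by
      have := ((((hasDerivAt_id s).sub_const 1).mul_const (y j)).smul_const
        (Pi.single j 1 : Fin n → ℝ)).const_add y
      simpa using this
    have h2 := ((hG.differentiable (by simp))
      (y + ((s - 1) * y j) • (Pi.single j 1 : Fin n → ℝ))).hasFDerivAt.comp_hasDerivAt s h1
    rw [map_smul, smul_eq_mul] at h2
    exact h2
  have hcont : Continuous fun s : ℝ =>
      y j * partialDeriv j G (y + ((s - 1) * y j) • (Pi.single j 1 : Fin n → ℝ)) :=
    continuous_const.mul (hG'.continuous.comp (by fun_prop))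
  have hFTC := intervalIntegral.integral_eq_sub_of_hasDerivAt (a := 0) (b := 1)
    (fun s _ => hder s) (hcont.intervalIntegrable _ _)
  rw [intervalIntegral.integral_const_mul] at hFTC
  have hz : G (y + ((0 - 1 : ℝ) * y j) • (Pi.single j 1 : Fin n → ℝ)) = 0 := h0 _ (by simp)
  rw [hz] at hFTC
  simpa using hFTC.symm

/-- A smooth function on an open set vanishing on `{y_j = 0}` is smoothly divisible by `y_j`. -/
theorem exists_eq_coord_mul {n : ℕ} (j : Fin n) {O : Set (Fin n → ℝ)} (hO : IsOpen O)
    {G : (Fin n → ℝ) → ℝ} (hG : ContDiffOn ℝ ∞ G O) (h0 : ∀ y ∈ O, y j = 0 → G y = 0) :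
    ∃ H : (Fin n → ℝ) → ℝ, ContDiffOn ℝ ∞ H O ∧ ∀ y ∈ O, G y = y j * H y := by
  -- An explicit global formula, so that smoothness can be checked point by point after a cutoff; on
  -- `y_j = 0` the derivative is the value forced by `G = y_j H`.
  refine ⟨fun y => if y j = 0 then partialDeriv j G y else G y / y j, ?_, ?_⟩
  · intro x hx
    refine ContDiffAt.contDiffWithinAt ?_
    by_cases hxj : x j = 0
    · obtain ⟨χ, hχ1, hχ0, hχ⟩ := exists_cutoff hO hx
      obtain ⟨H, hH, hGH⟩ := exists_eq_coord_mul_of_contDiff j (hχ G hG) (fun y hy => by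
        by_cases hyO : y ∈ O
        · simp [h0 y hyO hy]
        · simp [hχ0 y hyO])
      refine hH.contDiffAt.congr_of_eventuallyEq ?_
      filter_upwards [hχ1.eventuallyEq_nhds] with y hy
      have hloc : G =ᶠ[𝓝 y] fun z => z j * H z := by
        filter_upwards [hy] with z hz
        rw [← hGH z, hz]; simp
      split_ifs with hyj
      · rw [partialDeriv, hloc.fderiv_eq]
        have : HasFDerivAt (fun z : Fin n → ℝ => z j * H z) _ y :=
          (hasFDerivAt_apply j y).mul ((hH.differentiable (by simp)) y).hasFDerivAt
        rw [this.fderiv]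
        simp [hyj]
      · rw [hloc.eq_of_nhds]; field_simp
    · have h1 : ContDiffAt ℝ ∞ (fun y => G y / y j) x :=
        (hG.contDiffAt (hO.mem_nhds hx)).div (by fun_prop) hxj
      refine h1.congr_of_eventuallyEq ?_
      have : ∀ᶠ y : Fin n → ℝ in 𝓝 x, y j ≠ 0 :=
        (continuous_apply j).continuousAt.eventually_ne hxj
      filter_upwards [this] with y hy
      simp [hy]
  · intro y hy
    by_cases hyj : y j = 0
    · simp [hyj, h0 y hy hyj]
    · simp only [hyj, if_false]; field_simp

/-- Hadamard's lemma at the origin. -/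
theorem exists_eq_add_sum_coord_mul {n : ℕ} {f : (Fin n → ℝ) → ℝ} (hf : ContDiff ℝ ∞ f) :
    ∃ g : Fin n → (Fin n → ℝ) → ℝ, (∀ i, ContDiff ℝ ∞ (g i)) ∧
      ∀ x, f x = f 0 + ∑ i, x i * g i x := by
  have hpd : ∀ i, ContDiff ℝ ∞ (partialDeriv i f) := fun i =>
    (hf.fderiv_right (by simp)).clm_apply contDiff_const
  have hΦ : ∀ i, ContDiff ℝ ∞ fun p : ℝ × (Fin n → ℝ) => partialDeriv i f (p.1 • p.2) :=
    fun i => (hpd i).comp (by fun_prop)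
  refine ⟨_, fun i => contDiff_integral_of_contDiff (hΦ i), fun x => ?_⟩
  have hder : ∀ s : ℝ, HasDerivAt (fun s : ℝ => f (s • x))
      (∑ i, x i * partialDeriv i f (s • x)) s := by
    intro s
    have h1 : HasDerivAt (fun s : ℝ => s • x) x s := by
      simpa using (hasDerivAt_id s).smul_const x
    have h2 := ((hf.differentiable (by simp)) (s • x)).hasFDerivAt.comp_hasDerivAt s h1
    have hsum : fderiv ℝ f (s • x) x = ∑ i, x i * partialDeriv i f (s • x) := by
      conv_lhs => enter [2]; rw [← Finset.univ_sum_single x]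
      rw [map_sum]
      refine Finset.sum_congr rfl fun i _ => ?_
      rw [partialDeriv, ← smul_eq_mul, ← map_smul, ← Pi.single_smul, smul_eq_mul, mul_one]
    rw [hsum] at h2
    exact h2
  have hc : ∀ i, Continuous fun s : ℝ => x i * partialDeriv i f (s • x) := fun i =>
    continuous_const.mul ((hpd i).continuous.comp (by fun_prop))
  have hFTC := intervalIntegral.integral_eq_sub_of_hasDerivAt (a := 0) (b := 1)
    (fun s _ => hder s) ((continuous_finsetSum _ fun i _ => hc i).intervalIntegrable _ _)
  rw [intervalIntegral.integral_finsetSum fun i _ => (hc i).intervalIntegrable _ _] at hFTC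
  simp only [intervalIntegral.integral_const_mul, one_smul, zero_smul] at hFTC
  rw [hFTC]; ring

/-! ### Taylor coefficients -/

theorem contDiff_partialDeriv {n : ℕ} (i : Fin n) {f : (Fin n → ℝ) → ℝ} (hf : ContDiff ℝ ∞ f) :
    ContDiff ℝ ∞ (partialDeriv i f) :=
  (hf.fderiv_right (by simp)).clm_apply contDiff_const

theorem contDiff_iterate_partialDeriv {n : ℕ} (i : Fin n) (k : ℕ) {f : (Fin n → ℝ) → ℝ}
    (hf : ContDiff ℝ ∞ f) : ContDiff ℝ ∞ ((partialDeriv i)^[k] f) := by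
  induction k with
  | zero => exact hf
  | succ k ih => rw [Function.iterate_succ_apply']; exact contDiff_partialDeriv i ih

theorem partialDeriv_add {n : ℕ} (i : Fin n) {f g : (Fin n → ℝ) → ℝ} (hf : ContDiff ℝ ∞ f)
    (hg : ContDiff ℝ ∞ g) : partialDeriv i (f + g) = partialDeriv i f + partialDeriv i g := by
  ext x
  simp only [partialDeriv, Pi.add_apply]
  rw [fderiv_add (hf.differentiable (by simp) x) (hg.differentiable (by simp) x)]
  rfl

theorem partialDeriv_smul {n : ℕ} (i : Fin n) (c : ℝ) {f : (Fin n → ℝ) → ℝ}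
    (hf : ContDiff ℝ ∞ f) : partialDeriv i (c • f) = c • partialDeriv i f := by
  ext x
  simp only [partialDeriv, Pi.smul_apply]
  rw [fderiv_const_smul (hf.differentiable (by simp) x)]
  rfl

theorem partialDeriv_coord_mul {n : ℕ} (i j : Fin n) {g : (Fin n → ℝ) → ℝ}
    (hg : ContDiff ℝ ∞ g) :
    partialDeriv i (fun x => x j * g x) =
      (fun x => x j * partialDeriv i g x) + (if i = j then (1 : ℝ) else 0) • g := by
  ext x
  have h := ((hasFDerivAt_apply (𝕜 := ℝ) j x).mul
    ((hg.differentiable (by simp)) x).hasFDerivAt).fderiv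
  simp only [partialDeriv]
  erw [h]
  by_cases hij : i = j
  · subst hij; simp
  · simp [hij, Ne.symm hij]

theorem iterate_partialDeriv_add {n : ℕ} (i : Fin n) (k : ℕ) {f g : (Fin n → ℝ) → ℝ}
    (hf : ContDiff ℝ ∞ f) (hg : ContDiff ℝ ∞ g) :
    (partialDeriv i)^[k] (f + g) = (partialDeriv i)^[k] f + (partialDeriv i)^[k] g := by
  induction k with
  | zero => rfl
  | succ k ih =>
    simp only [Function.iterate_succ_apply', ih]
    exact partialDeriv_add i (contDiff_iterate_partialDeriv i k hf)
      (contDiff_iterate_partialDeriv i k hg)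

theorem iterate_partialDeriv_smul {n : ℕ} (i : Fin n) (k : ℕ) (c : ℝ) {f : (Fin n → ℝ) → ℝ}
    (hf : ContDiff ℝ ∞ f) : (partialDeriv i)^[k] (c • f) = c • (partialDeriv i)^[k] f := by
  induction k with
  | zero => rfl
  | succ k ih =>
    simp only [Function.iterate_succ_apply', ih]
    exact partialDeriv_smul i c (contDiff_iterate_partialDeriv i k hf)

theorem iterate_partialDeriv_coord_mul_of_ne {n : ℕ} {i j : Fin n} (hij : i ≠ j) (k : ℕ)
    {g : (Fin n → ℝ) → ℝ} (hg : ContDiff ℝ ∞ g) :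
    (partialDeriv i)^[k] (fun x => x j * g x) = fun x => x j * (partialDeriv i)^[k] g x := by
  induction k with
  | zero => rfl
  | succ k ih =>
    simp only [Function.iterate_succ_apply', ih]
    rw [partialDeriv_coord_mul i j (contDiff_iterate_partialDeriv i k hg)]
    simp [hij]

/-- Leibniz's rule stops after two terms since `x_j` is linear. At `k = 0` the truncated `k - 1` is
harmless, its coefficient being 0. -/
theorem iterate_partialDeriv_coord_mul {n : ℕ} (j : Fin n) (k : ℕ)
    {g : (Fin n → ℝ) → ℝ} (hg : ContDiff ℝ ∞ g) :
    (partialDeriv j)^[k] (fun x => x j * g x) =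
      (fun x => x j * (partialDeriv j)^[k] g x) + (k : ℝ) • (partialDeriv j)^[k - 1] g := by
  induction k with
  | zero => ext; simp
  | succ k ih =>
    have hk := contDiff_iterate_partialDeriv j k hg
    have hk' := contDiff_iterate_partialDeriv j (k - 1) hg
    have hsmul : ContDiff ℝ ∞ ((k : ℝ) • (partialDeriv j)^[k - 1] g) := contDiff_const.smul hk'
    rw [Function.iterate_succ_apply', ih, partialDeriv_add j (by fun_prop) hsmul, partialDeriv_smul j _ hk', partialDeriv_coord_mul j j hk]
    rcases k with _ | k
    · ext; simp
    · ext x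
      simp only [Nat.add_sub_cancel, ← Function.iterate_succ_apply' (partialDeriv j),
        Pi.add_apply, Pi.smul_apply, if_true, smul_eq_mul]
      push_cast
      ring

/-- The composition of the operators `(∂/∂x_i)^{α_i}`, for `i` in a list. -/
def listPartial {n : ℕ} (L : List (Fin n)) (α : Fin n → ℕ) (f : (Fin n → ℝ) → ℝ) :
    (Fin n → ℝ) → ℝ :=
  L.foldr (fun i g => (partialDeriv i)^[α i] g) f

theorem listPartial_cons {n : ℕ} (i : Fin n) (L : List (Fin n)) (α : Fin n → ℕ)
    (f : (Fin n → ℝ) → ℝ) :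
    listPartial (i :: L) α f = (partialDeriv i)^[α i] (listPartial L α f) := rfl

theorem contDiff_listPartial {n : ℕ} (L : List (Fin n)) (α : Fin n → ℕ)
    {f : (Fin n → ℝ) → ℝ} (hf : ContDiff ℝ ∞ f) : ContDiff ℝ ∞ (listPartial L α f) := by
  induction L with
  | nil => exact hf
  | cons i L ih => exact contDiff_iterate_partialDeriv i _ ih

theorem listPartial_add {n : ℕ} (L : List (Fin n)) (α : Fin n → ℕ) {f g : (Fin n → ℝ) → ℝ}
    (hf : ContDiff ℝ ∞ f) (hg : ContDiff ℝ ∞ g) :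
    listPartial L α (f + g) = listPartial L α f + listPartial L α g := by
  induction L with
  | nil => rfl
  | cons i L ih =>
    simp only [listPartial_cons, ih]
    exact iterate_partialDeriv_add i _ (contDiff_listPartial L α hf) (contDiff_listPartial L α hg)

theorem listPartial_congr_exponent {n : ℕ} (L : List (Fin n)) {α β : Fin n → ℕ}
    (h : ∀ i ∈ L, α i = β i) (f : (Fin n → ℝ) → ℝ) :
    listPartial L α f = listPartial L β f := by
  induction L with
  | nil => rfl
  | cons i L ih =>
    simp only [List.mem_cons, forall_eq_or_imp] at h
    simp only [listPartial_cons, ih h.2, h.1]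

theorem listPartial_coord_mul_of_notMem {n : ℕ} (L : List (Fin n)) (α : Fin n → ℕ) {j : Fin n}
    (hj : j ∉ L) {g : (Fin n → ℝ) → ℝ} (hg : ContDiff ℝ ∞ g) :
    listPartial L α (fun x => x j * g x) = fun x => x j * listPartial L α g x := by
  induction L with
  | nil => rfl
  | cons i L ih =>
    simp only [List.mem_cons, not_or] at hj
    simp only [listPartial_cons, ih hj.2]
    exact iterate_partialDeriv_coord_mul_of_ne (Ne.symm hj.1) _ (contDiff_listPartial L α hg)

/-- Without repetitions, `j` is met exactly once and only that operator produces the extra term; the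
order of differentiation is never changed. -/
theorem listPartial_coord_mul {n : ℕ} (L : List (Fin n)) (hL : L.Nodup) (α : Fin n → ℕ)
    {j : Fin n} (hj : j ∈ L) {g : (Fin n → ℝ) → ℝ} (hg : ContDiff ℝ ∞ g) :
    listPartial L α (fun x => x j * g x) =
      (fun x => x j * listPartial L α g x) +
        (α j : ℝ) • listPartial L (α - Pi.single j 1) g := by
  induction L with
  | nil => simp at hj
  | cons i L ih =>
    have hsm := contDiff_listPartial L α hg
    have hsm' := contDiff_listPartial L (α - Pi.single j 1) hg
    rw [List.nodup_cons] at hL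
    rcases eq_or_ne i j with rfl | hij
    · simp only [listPartial_cons, listPartial_coord_mul_of_notMem L α hL.1 hg]
      rw [iterate_partialDeriv_coord_mul i _ hsm, listPartial_congr_exponent L (α := α)
        (β := α - Pi.single i 1) _ g]
      · simp
      · intro k hk
        have : k ≠ i := fun h => hL.1 (h ▸ hk)
        simp [this]
    · have hjL : j ∈ L := by simpa [Ne.symm hij] using hj
      simp only [listPartial_cons, ih hL.2 hjL]
      have hsmul : ContDiff ℝ ∞ ((α j : ℝ) • listPartial L (α - Pi.single j 1) g) :=
        contDiff_const.smul hsm'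
      rw [iterate_partialDeriv_add i _ (by fun_prop) hsmul,
        iterate_partialDeriv_coord_mul_of_ne hij _ hsm, iterate_partialDeriv_smul i _ _ hsm']
      simp [hij]

theorem listPartial_const {n : ℕ} (L : List (Fin n)) (α : Fin n → ℕ) (c : ℝ) :
    listPartial L α (fun _ => c) = fun _ => if ∀ i ∈ L, α i = 0 then c else 0 := by
  have hz : ∀ (i : Fin n) (k : ℕ) (d : ℝ),
      (partialDeriv i)^[k] (fun _ => d) = fun _ => if k = 0 then d else 0 := by
    intro i k d
    induction k with
    | zero => simp
    | succ k ih => rw [Function.iterate_succ_apply', ih]; ext; simp [partialDeriv]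
  induction L with
  | nil => simp [listPartial]
  | cons i L ih =>
    rw [listPartial_cons, ih, hz]
    ext
    simp only [List.mem_cons, forall_eq_or_imp]
    split_ifs <;> simp_all

theorem eventuallyEq_listPartial {n : ℕ} (L : List (Fin n)) (α : Fin n → ℕ)
    {f g : (Fin n → ℝ) → ℝ} {x : Fin n → ℝ} (h : f =ᶠ[𝓝 x] g) :
    listPartial L α f =ᶠ[𝓝 x] listPartial L α g := by
  have hstep : ∀ (i : Fin n) (k : ℕ) {f g : (Fin n → ℝ) → ℝ}, f =ᶠ[𝓝 x] g →
      (partialDeriv i)^[k] f =ᶠ[𝓝 x] (partialDeriv i)^[k] g := by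
    intro i k f g h
    induction k with
    | zero => exact h
    | succ k ih =>
      simp only [Function.iterate_succ_apply']
      filter_upwards [ih.fderiv (𝕜 := ℝ)] with y hy
      simp [partialDeriv, hy]
  induction L with
  | nil => exact h
  | cons i L ih => exact hstep i _ ih

theorem taylorCoeff_congr {n : ℕ} {f g : (Fin n → ℝ) → ℝ} (h : f =ᶠ[𝓝 0] g) :
    taylorCoeff f = taylorCoeff g := by
  ext α
  exact congrArg (· / _) (eventuallyEq_listPartial (List.finRange n) α h).eq_of_nhds

theorem taylorCoeff_add {n : ℕ} {f g : (Fin n → ℝ) → ℝ} (hf : ContDiff ℝ ∞ f)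
    (hg : ContDiff ℝ ∞ g) (α : Fin n → ℕ) :
    taylorCoeff (f + g) α = taylorCoeff f α + taylorCoeff g α := by
  rw [taylorCoeff, taylorCoeff, taylorCoeff, ← add_div]
  congr 1
  exact congrFun (listPartial_add (List.finRange n) α hf hg) 0

theorem taylorCoeff_const {n : ℕ} (c : ℝ) (α : Fin n → ℕ) :
    taylorCoeff (fun _ => c) α = if α = 0 then c else 0 := by
  have h : mixedPartial α (fun _ => c) 0 = if ∀ i ∈ List.finRange n, α i = 0 then c else 0 :=
    congrFun (listPartial_const (List.finRange n) α c) 0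
  rw [taylorCoeff, h]
  simp only [List.mem_finRange, true_implies, funext_iff, Pi.zero_apply]
  split_ifs with h0
  · simp [h0]
  · simp

theorem taylorCoeff_sum {n : ℕ} {ι : Type*} (s : Finset ι) {g : ι → (Fin n → ℝ) → ℝ}
    (hg : ∀ i, ContDiff ℝ ∞ (g i)) (α : Fin n → ℕ) :
    taylorCoeff (fun x => ∑ i ∈ s, g i x) α = ∑ i ∈ s, taylorCoeff (g i) α := by
  classical
  induction s using Finset.induction_on with
  | empty => simpa using taylorCoeff_const (0 : ℝ) α
  | insert i s hi ih =>
    simp only [Finset.sum_insert hi]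
    rw [← ih]
    exact taylorCoeff_add (hg i) (ContDiff.sum fun i _ => hg i) α

/-- The factor `α_j` from Leibniz's rule cancels against `α! = α_j (α - e_j)!`. This shift of the
series drives the induction in Taylor's formula. -/
theorem taylorCoeff_coord_mul {n : ℕ} (j : Fin n) {g : (Fin n → ℝ) → ℝ} (hg : ContDiff ℝ ∞ g)
    (α : Fin n → ℕ) :
    taylorCoeff (fun x => x j * g x) α =
      if α j = 0 then 0 else taylorCoeff g (α - Pi.single j 1) := by
  have h : mixedPartial α (fun x => x j * g x) 0 =
      α j * mixedPartial (α - Pi.single j 1) g 0 := by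
    have := congrFun (listPartial_coord_mul (List.finRange n) (List.nodup_finRange n) α
      (List.mem_finRange j) hg) 0
    simpa [listPartial, mixedPartial] using this
  rw [taylorCoeff, h]
  split_ifs with hj
  · simp [hj]
  · have hfac : (∏ i, ((α i).factorial : ℝ)) =
        α j * ∏ i, (((α - Pi.single j 1 : Fin n → ℕ) i).factorial : ℝ) := by
      obtain ⟨β, hβ⟩ : ∃ β : Fin n → ℕ, β = α - Pi.single j 1 := ⟨_, rfl⟩
      have hβj : α j * (β j).factorial = (α j).factorial := by
        simpa [hβ] using Nat.mul_factorial_pred hj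
      rw [← hβ, ← Finset.mul_prod_erase _ _ (Finset.mem_univ j),
        ← Finset.mul_prod_erase _ (fun i => ((β i).factorial : ℝ)) (Finset.mem_univ j),
        ← mul_assoc, ← hβj]
      push_cast
      congr 1
      refine Finset.prod_congr rfl fun i hi => ?_
      simp [hβ, Finset.ne_of_mem_erase hi]
    have hj' : (α j : ℝ) ≠ 0 := by exact_mod_cast hj
    rw [taylorCoeff, hfac, mul_div_mul_left _ _ hj']

/-- Taylor's formula at the origin, with the Taylor coefficients `c_α`. -/
theorem exists_taylor_polynomial {n : ℕ} (N : ℕ) {f : (Fin n → ℝ) → ℝ} (hf : ContDiff ℝ ∞ f) :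
    ∃ p : MvPolynomial (Fin n) ℝ,
      (∀ α : Fin n →₀ ℕ, α.degree < N → p.coeff α = taylorCoeff f α) ∧
      (fun x => f x - MvPolynomial.eval x p) =O[𝓝 0] fun x => ‖x‖ ^ N := by
  induction N generalizing f with
  | zero =>
    refine ⟨0, by simp, ?_⟩
    simpa using hf.continuous.continuousAt.isBigO_one ℝ
  | succ N ih =>
    obtain ⟨g, hg, hfg⟩ := exists_eq_add_sum_coord_mul hf
    choose p hp hpO using fun i => ih (hg i)
    -- Hadamard's lemma gives `f = f(0) + ∑ x_i g_i`, and each `g_i` is replaced by its polynomial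
    -- of the preceding order.
    refine ⟨MvPolynomial.C (f 0) + ∑ i, MvPolynomial.X i * p i, fun α hα => ?_, ?_⟩
    · have hf' : f = (fun _ => f 0) + fun x => ∑ i, x i * g i x := funext hfg
      have hsm : ∀ i, ContDiff ℝ ∞ fun x : Fin n → ℝ => x i * g i x := fun i => by
        have := hg i
        fun_prop
      rw [hf', taylorCoeff_add contDiff_const (ContDiff.sum fun i _ => hsm i), taylorCoeff_const,
        taylorCoeff_sum _ hsm]
      simp only [MvPolynomial.coeff_add, MvPolynomial.coeff_C, MvPolynomial.coeff_sum,
        MvPolynomial.coeff_X_mul', taylorCoeff_coord_mul _ (hg _)]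
      congr 1
      · simp [eq_comm, DFunLike.ext_iff, funext_iff]
      · refine Finset.sum_congr rfl fun i _ => ?_
        simp only [Finsupp.mem_support_iff, ne_eq, ite_not]
        split_ifs with hi
        · rfl
        · have hle : Finsupp.single i 1 ≤ α := by
            rw [Finsupp.single_le_iff]; omega
          rw [hp]
          · congr 1
            ext k
            simp [Finsupp.single_apply, Pi.single_apply, eq_comm]
          · have := congrArg Finsupp.degree (tsub_add_cancel_of_le hle)
            rw [map_add, Finsupp.degree_single] at this
            omega
    · have hterm : ∀ i, (fun x : Fin n → ℝ => x i * (g i x - MvPolynomial.eval x (p i)))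
          =O[𝓝 0] fun x => ‖x‖ ^ (N + 1) := by
        intro i
        have h1 : (fun x : Fin n → ℝ => x i) =O[𝓝 0] fun x => ‖x‖ :=
          Asymptotics.IsBigO.of_bound 1 (Eventually.of_forall fun x => by
            simpa using norm_le_pi_norm x i)
        simpa [pow_succ'] using h1.mul (hpO i)
      refine (Asymptotics.IsBigO.sum (s := Finset.univ) fun i _ => hterm i).congr_left fun x => ?_
      rw [hfg x]
      simp [mul_sub]

/-! ### Quasihomogeneous parts -/

/-- The exponents `α` with `⟨b,α⟩ = L`, for a weight `b` with positive entries. -/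
def exponentsOfWeight {n : ℕ} (b : Fin n → ℕ) (L : ℕ) : Finset (Fin n → ℕ) :=
  (Fintype.piFinset fun _ => Finset.range (L + 1)).filter fun α => b ⬝ᵥ α = L

/-- The sum of the terms `c_α x^α` with `⟨b,α⟩ = L` of the Taylor series of `f`. -/
def weightPart {n : ℕ} (f : (Fin n → ℝ) → ℝ) (b : Fin n → ℕ) (L : ℕ) (x : Fin n → ℝ) : ℝ :=
  ∑ α ∈ exponentsOfWeight b L, taylorCoeff f α * ∏ i, x i ^ α i

/-- Positive weights force `α_i ≤ ⟨b,α⟩ = L`, so the box in the definition loses nothing. -/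
theorem mem_exponentsOfWeight {n : ℕ} {b : Fin n → ℕ} (hb : ∀ i, 0 < b i) {L : ℕ}
    {α : Fin n → ℕ} : α ∈ exponentsOfWeight b L ↔ b ⬝ᵥ α = L := by
  simp only [exponentsOfWeight, Finset.mem_filter, Fintype.mem_piFinset, Finset.mem_range,
    and_iff_right_iff_imp]
  intro h i
  have h1 : b i * α i ≤ b ⬝ᵥ α :=
    Finset.single_le_sum (f := fun i => b i * α i) (fun _ _ => Nat.zero_le _) (Finset.mem_univ i)
  have h2 := Nat.le_mul_of_pos_left (α i) (hb i)
  omega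

theorem tendsto_scaling {n : ℕ} {b : Fin n → ℕ} (hb : ∀ i, 0 < b i) (x : Fin n → ℝ) :
    Tendsto (fun t : ℝ => fun i => t ^ b i * x i) (𝓝[≠] 0) (𝓝 0) := by
  refine Tendsto.mono_left ?_ nhdsWithin_le_nhds
  have h : Continuous fun t : ℝ => fun i => t ^ b i * x i := by fun_prop
  have h0 : (fun i => (0 : ℝ) ^ b i * x i) = 0 := by
    ext i; simp [(hb i).ne']
  simpa [h0] using h.tendsto 0

theorem tendsto_pow_div_pow (k L : ℕ) (h : L ≤ k) :
    Tendsto (fun t : ℝ => t ^ k / t ^ L) (𝓝[≠] 0) (𝓝 (if k = L then 1 else 0)) := by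
  have h1 : Tendsto (fun t : ℝ => t ^ (k - L)) (𝓝[≠] 0) (𝓝 (0 ^ (k - L))) :=
    ((continuous_pow (k - L)).tendsto 0).mono_left nhdsWithin_le_nhds
  have h2 : (0 : ℝ) ^ (k - L) = if k = L then 1 else 0 := by
    rw [zero_pow_eq]
    congr 1
    rw [eq_iff_iff]
    omega
  rw [← h2]
  refine h1.congr' ?_
  filter_upwards [self_mem_nhdsWithin] with t ht
  rw [pow_sub₀ _ ht h, div_eq_mul_inv]

theorem degree_le_weight {n : ℕ} {b : Fin n → ℕ} (hb : ∀ i, 0 < b i) (α : Fin n →₀ ℕ) :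
    α.degree ≤ b ⬝ᵥ ⇑α := by
  rw [Finsupp.degree_eq_sum]
  exact Finset.sum_le_sum fun i _ => Nat.le_mul_of_pos_left (α i) (hb i)

theorem prod_scaling {n : ℕ} (b α : Fin n → ℕ) (x : Fin n → ℝ) (t : ℝ) :
    ∏ i, (t ^ b i * x i) ^ α i = t ^ (b ⬝ᵥ α) * ∏ i, x i ^ α i := by
  simp only [mul_pow, Finset.prod_mul_distrib, ← pow_mul, dotProduct, Finset.prod_pow_eq_pow_sum]

/-- For positive weights the weight of an exponent is at least its degree. Taylor's formula of order
`L + 1` thus sees every term of weight at most `L`, and its remainder at `t^b x` is `O(t^{L+1})`. -/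
theorem tendsto_scaledQuotient_of_contDiff {n : ℕ} {f : (Fin n → ℝ) → ℝ} (hf : ContDiff ℝ ∞ f)
    {b : Fin n → ℕ} (hb : ∀ i, 0 < b i) {L : ℕ}
    (hL : ∀ α, taylorCoeff f α ≠ 0 → L ≤ b ⬝ᵥ α) (x : Fin n → ℝ) :
    Tendsto (scaledQuotient f b L x) (𝓝[≠] 0) (𝓝 (weightPart f b L x)) := by
  obtain ⟨p, hp, hO⟩ := exists_taylor_polynomial (L + 1) hf
  -- Coefficients of `p` in degree above `L` are not controlled, but their weight exceeds `L`
  -- anyway.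
  have hpL : ∀ α ∈ p.support, L ≤ b ⬝ᵥ ⇑α := by
    intro α hα
    by_cases hd : α.degree < L + 1
    · refine hL _ ?_
      rw [← hp α hd]
      exact MvPolynomial.mem_support_iff.1 hα
    · have := degree_le_weight hb α
      omega
  have hpoly : Tendsto (fun t : ℝ => MvPolynomial.eval (fun i => t ^ b i * x i) p / t ^ L)
      (𝓝[≠] 0) (𝓝 (∑ α ∈ p.support,
        (p.coeff α * ∏ i, x i ^ α i) * if b ⬝ᵥ ⇑α = L then 1 else 0)) := by
    refine Tendsto.congr (fun t => ?_) (tendsto_finsetSum p.support fun α hα =>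
      (tendsto_pow_div_pow _ L (hpL α hα)).const_mul (p.coeff α * ∏ i, x i ^ α i))
    rw [MvPolynomial.eval_eq', Finset.sum_div]
    refine Finset.sum_congr rfl fun α _ => ?_
    rw [prod_scaling]
    ring
  have hrem : Tendsto (fun t : ℝ => (f (fun i => t ^ b i * x i) -
      MvPolynomial.eval (fun i => t ^ b i * x i) p) / t ^ L) (𝓝[≠] 0) (𝓝 0) := by
    have h1 := hO.comp_tendsto (tendsto_scaling hb x)
    have h2 : (fun t : ℝ => fun i => t ^ b i * x i) =O[𝓝[≠] 0] fun t => t := by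
      refine Asymptotics.IsBigO.of_bound ‖x‖ ?_
      have hball : ∀ᶠ t : ℝ in 𝓝[≠] 0, ‖t‖ ≤ 1 :=
        nhdsWithin_le_nhds <| mem_of_superset (Metric.closedBall_mem_nhds (0 : ℝ) one_pos) fun t ht => by
          simpa using ht
      filter_upwards [hball] with t ht
      refine (pi_norm_le_iff_of_nonneg (by positivity)).2 fun i => ?_
      rw [norm_mul, norm_pow, mul_comm]
      exact mul_le_mul (norm_le_pi_norm x i) (pow_le_of_le_one (norm_nonneg _) ht (hb i).ne')
        (by positivity) (norm_nonneg _)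
    have h3 := (h1.trans (h2.norm_left.pow (L + 1))).mul
      (Asymptotics.isBigO_refl (fun t : ℝ => (t ^ L)⁻¹) _)
    have h4 : Tendsto (fun t : ℝ => t ^ (L + 1) * (t ^ L)⁻¹) (𝓝[≠] 0) (𝓝 0) := by
      simpa [div_eq_mul_inv] using tendsto_pow_div_pow (L + 1) L (by omega)
    simpa [div_eq_mul_inv] using h3.trans_tendsto h4
  have hsum : ∑ α ∈ p.support, (p.coeff α * ∏ i, x i ^ α i) * (if b ⬝ᵥ ⇑α = L then 1 else 0) =
      weightPart f b L x := by
    have hlow : ∀ α : Fin n →₀ ℕ, b ⬝ᵥ ⇑α = L → p.coeff α = taylorCoeff f α := fun α hα =>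
      hp α (by have := degree_le_weight hb α; omega)
    refine Finset.sum_bij_ne_zero (fun α _ _ => ⇑α) ?_ ?_ ?_ ?_
    · intro α _ h
      rw [mem_exponentsOfWeight hb]
      by_contra hne
      simp [hne] at h
    · intro α _ _ β _ _ h
      exact DFunLike.coe_injective h
    · intro α hα h
      have hw := (mem_exponentsOfWeight hb).1 hα
      have hc := hlow (Finsupp.equivFunOnFinite.symm α) hw
      rw [Finsupp.coe_equivFunOnFinite_symm] at hc
      refine ⟨Finsupp.equivFunOnFinite.symm α, ?_, ?_, rfl⟩
      · rw [MvPolynomial.mem_support_iff, hc]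
        exact left_ne_zero_of_mul h
      · simpa [hc, hw] using h
    · intro α _ h
      have hw : b ⬝ᵥ ⇑α = L := by
        by_contra hne
        simp [hne] at h
      simp [hw, hlow α hw]
  rw [← hsum]
  refine Tendsto.congr (fun t => ?_) (by simpa using hpoly.add hrem)
  rw [scaledQuotient, ← add_div]
  ring_nf

/-- For positive weights, the limits of `f(t^b x) / t^L` exist and are given by the terms of
lowest weight of the Taylor series. -/
theorem tendsto_scaledQuotient {n : ℕ} {O : Set (Fin n → ℝ)} (hO : IsOpen O)
    (h0 : (0 : Fin n → ℝ) ∈ O) {f : (Fin n → ℝ) → ℝ} (hf : ContDiffOn ℝ ∞ f O)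
    {b : Fin n → ℕ} (hb : ∀ i, 0 < b i) {L : ℕ}
    (hL : ∀ α, taylorCoeff f α ≠ 0 → L ≤ b ⬝ᵥ α) (x : Fin n → ℝ) :
    Tendsto (scaledQuotient f b L x) (𝓝[≠] 0) (𝓝 (weightPart f b L x)) := by
  obtain ⟨χ, hχ1, -, hχ⟩ := exists_cutoff hO h0
  have hloc : (fun x => χ x * f x) =ᶠ[𝓝 0] f := by
    filter_upwards [hχ1] with z hz
    simp [hz]
  have hT := taylorCoeff_congr hloc
  have h := tendsto_scaledQuotient_of_contDiff (hχ f hf) hb (by rwa [hT]) x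
  have hw : weightPart (fun x => χ x * f x) b L x = weightPart f b L x := by
    simp only [weightPart, hT]
  rw [hw] at h
  refine h.congr' ?_
  filter_upwards [(tendsto_scaling hb x).eventually hloc] with t ht
  simp only [scaledQuotient]
  rw [ht]

theorem contDiff_weightPart {n : ℕ} (f : (Fin n → ℝ) → ℝ) (b : Fin n → ℕ) (L : ℕ) :
    ContDiff ℝ ∞ (weightPart f b L) :=
  ContDiff.sum fun _ _ => contDiff_const.mul
    (contDiff_prod fun i _ => (contDiff_apply ℝ ℝ i).pow _)

/-! ### Faces of Newton polyhedra -/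

/-- A supporting hyperplane commutes with taking convex hulls. -/
theorem convexHull_inter_hyperplane {n : ℕ} {G : Set (Fin n → ℝ)} {a : Fin n → ℝ} {l : ℝ}
    (h : IsValid G a l) :
    convexHull ℝ G ∩ hyperplane a l = convexHull ℝ (G ∩ hyperplane a l) := by
  have hlin : IsLinearMap ℝ fun x : Fin n → ℝ => a ⬝ᵥ x :=
    ⟨fun x y => dotProduct_add a x y, fun c x => dotProduct_smul c a x⟩
  apply Subset.antisymm
  · rintro x ⟨hx, hxl⟩
    -- A proper convex combination of two points of this union meets the hyperplane only if both
    -- points lie on it. The union contains `G`, hence its hull.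
    have hconv : Convex ℝ ({x | l < a ⬝ᵥ x} ∪ convexHull ℝ (G ∩ hyperplane a l)) := by
      have hge : ∀ x ∈ convexHull ℝ (G ∩ hyperplane a l), a ⬝ᵥ x = l := fun x hx =>
        convexHull_min inter_subset_right (convex_hyperplane hlin l) hx
      have hle : ∀ x ∈ ({x | l < a ⬝ᵥ x} ∪ convexHull ℝ (G ∩ hyperplane a l)), l ≤ a ⬝ᵥ x := by
        rintro x (hx | hx)
        · exact le_of_lt hx
        · exact (hge x hx).ge
      rintro x hx y hy s t hs ht hst
      rcases hs.eq_or_lt with rfl | hs'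
      · rw [zero_add] at hst; subst hst; simpa using hy
      rcases ht.eq_or_lt with rfl | ht'
      · rw [add_zero] at hst; subst hst; simpa using hx
      have hval : a ⬝ᵥ (s • x + t • y) = s * (a ⬝ᵥ x) + t * (a ⬝ᵥ y) := by
        simp [dotProduct_add, dotProduct_smul]
      have hl : l = s * l + t * l := by rw [← add_mul, hst, one_mul]
      by_cases hboth : x ∈ convexHull ℝ (G ∩ hyperplane a l) ∧
          y ∈ convexHull ℝ (G ∩ hyperplane a l)
      · exact Or.inr (convex_convexHull ℝ _ hboth.1 hboth.2 hs ht hst)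
      · left
        rw [mem_ofPred_eq, hval]
        have hx' := hle x hx
        have hy' := hle y hy
        have hlt : l < a ⬝ᵥ x ∨ l < a ⬝ᵥ y := by
          rcases hx with hx | hx
          · exact Or.inl hx
          · rcases hy with hy | hy
            · exact Or.inr hy
            · exact absurd ⟨hx, hy⟩ hboth
        rcases hlt with hlt | hlt
        · have := mul_lt_mul_of_pos_left hlt hs'
          have := mul_le_mul_of_nonneg_left hy' ht
          linarith
        · have := mul_lt_mul_of_pos_left hlt ht'
          have := mul_le_mul_of_nonneg_left hx' hs
          linarith
    have hsub : G ⊆ {x | l < a ⬝ᵥ x} ∪ convexHull ℝ (G ∩ hyperplane a l) := by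
      intro z hz
      rcases (h z hz).eq_or_lt with hzl | hzl
      · exact Or.inr (subset_convexHull ℝ _ ⟨hz, hzl.symm⟩)
      · exact Or.inl hzl
    rcases convexHull_min hsub hconv hx with hx' | hx'
    · exact absurd hxl (ne_of_gt hx')
    · exact hx'
  · exact subset_inter (convexHull_mono inter_subset_left)
      (convexHull_min inter_subset_right (convex_hyperplane hlin l))

/-- The generators of the Newton polyhedron: the union of the sets `α + ℝ₊ⁿ` with `c_α ≠ 0`. -/
def newtonGenerators {n : ℕ} (f : (Fin n → ℝ) → ℝ) : Set (Fin n → ℝ) :=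
  {x | ∃ α : Fin n → ℕ, taylorCoeff f α ≠ 0 ∧ ∀ i, (α i : ℝ) ≤ x i}

theorem newtonPolyhedron_eq {n : ℕ} (f : (Fin n → ℝ) → ℝ) :
    newtonPolyhedron f = convexHull ℝ (newtonGenerators f) := rfl

theorem exponent_mem_newtonPolyhedron {n : ℕ} {f : (Fin n → ℝ) → ℝ} {α : Fin n → ℕ}
    (h : taylorCoeff f α ≠ 0) : (fun i => (α i : ℝ)) ∈ newtonPolyhedron f :=
  subset_convexHull ℝ _ ⟨α, h, fun _ => le_rfl⟩

theorem cast_dotProduct {n : ℕ} (a α : Fin n → ℕ) :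
    (fun i => (a i : ℝ)) ⬝ᵥ (fun i => (α i : ℝ)) = ((a ⬝ᵥ α : ℕ) : ℝ) := by
  simp [dotProduct]

theorem dotProduct_cast_mono {n : ℕ} (a : Fin n → ℕ) {x y : Fin n → ℝ} (h : ∀ i, x i ≤ y i) :
    (fun i => (a i : ℝ)) ⬝ᵥ x ≤ (fun i => (a i : ℝ)) ⬝ᵥ y :=
  Finset.sum_le_sum fun i _ => mul_le_mul_of_nonneg_left (h i) (Nat.cast_nonneg _)

/-- Otherwise all generators, and with them their hull, would lie in the open half-space `⟨b,·⟩ >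
⟨b,x⟩`, which cannot contain `x`. -/
theorem exists_exponent_le {n : ℕ} {f : (Fin n → ℝ) → ℝ} (b : Fin n → ℕ) {x : Fin n → ℝ}
    (hx : x ∈ newtonPolyhedron f) :
    ∃ α : Fin n → ℕ, taylorCoeff f α ≠ 0 ∧
      (fun i => (b i : ℝ)) ⬝ᵥ (fun i => (α i : ℝ)) ≤ (fun i => (b i : ℝ)) ⬝ᵥ x := by
  by_contra! hcon
  have hlin : IsLinearMap ℝ fun z : Fin n → ℝ => (fun i => (b i : ℝ)) ⬝ᵥ z :=
    ⟨fun x y => dotProduct_add _ x y, fun c x => dotProduct_smul c _ x⟩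
  have hsub : newtonGenerators f ⊆ {z | (fun i => (b i : ℝ)) ⬝ᵥ x < (fun i => (b i : ℝ)) ⬝ᵥ z} := by
    rintro z ⟨α, hα, hz⟩
    exact (hcon α hα).trans_le (dotProduct_cast_mono b hz)
  exact lt_irrefl ((fun i => (b i : ℝ)) ⬝ᵥ x)
    (convexHull_min hsub (convex_halfSpace_gt hlin _) hx)

theorem add_mem_newtonPolyhedron {n : ℕ} {f : (Fin n → ℝ) → ℝ} {x v : Fin n → ℝ}
    (hx : x ∈ newtonPolyhedron f) (hv : ∀ i, 0 ≤ v i) : x + v ∈ newtonPolyhedron f := by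
  have hsub : newtonGenerators f ⊆ (fun z => z + v) ⁻¹' newtonPolyhedron f := by
    rintro z ⟨α, hα, hz⟩
    exact subset_convexHull ℝ _ ⟨α, hα, fun i => (hz i).trans (le_add_of_nonneg_right (hv i))⟩
  exact convexHull_min hsub ((convex_convexHull ℝ _).translate_preimage_left v) hx

theorem DefinesFace.eq_convexHull {n : ℕ} {f : (Fin n → ℝ) → ℝ} {γ : Set (Fin n → ℝ)}
    {a : Fin n → ℕ} {l : ℕ} (h : DefinesFace (newtonPolyhedron f) γ a l) :
    γ = convexHull ℝ (newtonGenerators f ∩ hyperplane (fun i => (a i : ℝ)) l) := by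
  rw [h.2, newtonPolyhedron_eq, convexHull_inter_hyperplane]
  exact fun x hx => h.1 x (subset_convexHull ℝ _ hx)

theorem DefinesFace.isFace {n : ℕ} {P γ : Set (Fin n → ℝ)} {a : Fin n → ℕ} {l : ℕ}
    (h : DefinesFace P γ a l) : IsFace P γ :=
  ⟨fun i => a i, l, by simpa using h.1, by simpa using h.2⟩

theorem DefinesFace.le_weight {n : ℕ} {f : (Fin n → ℝ) → ℝ} {γ : Set (Fin n → ℝ)}
    {a : Fin n → ℕ} {l : ℕ} (h : DefinesFace (newtonPolyhedron f) γ a l) {α : Fin n → ℕ}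
    (hα : taylorCoeff f α ≠ 0) : l ≤ a ⬝ᵥ α := by
  have := h.1 _ (exponent_mem_newtonPolyhedron hα)
  rw [cast_dotProduct] at this
  exact_mod_cast this

/-- A point of a supporting hyperplane above an exponent agrees with it on the support. -/
theorem eq_of_dotProduct_eq {n : ℕ} (a : Fin n → ℕ) {x y : Fin n → ℝ} (hle : ∀ i, x i ≤ y i)
    (h : (fun i => (a i : ℝ)) ⬝ᵥ y ≤ (fun i => (a i : ℝ)) ⬝ᵥ x) {i : Fin n} (hi : a i ≠ 0) :
    y i = x i := by
  have heq := (Finset.sum_eq_sum_iff_of_le (s := Finset.univ)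
    (f := fun i => (a i : ℝ) * x i) (g := fun i => (a i : ℝ) * y i)
    (fun i _ => mul_le_mul_of_nonneg_left (hle i) (Nat.cast_nonneg _))).1
    (le_antisymm (dotProduct_cast_mono a hle) h) i (Finset.mem_univ i)
  exact (mul_left_cancel₀ (Nat.cast_ne_zero.2 hi) heq).symm

/-- Only finitely many faces of a Newton polyhedron are defined by pairs in `ℤ₊ⁿ × ℤ₊`. -/
theorem finite_definesFace {n : ℕ} (f : (Fin n → ℝ) → ℝ) :
    {γ | ∃ a l, DefinesFace (newtonPolyhedron f) γ a l}.Finite := by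
  -- Dickson's lemma: the minimal exponents form an antichain in `ℕⁿ`, hence a finite set.
  let M : Set (Fin n → ℕ) := {α | Minimal (fun α => taylorCoeff f α ≠ 0) α}
  have hM : M.Finite := by
    refine WellQuasiOrderedLE.finite_of_isAntichain ?_
    exact setOfPred_minimal_antichain _
  -- A face is determined by the minimal exponents on its hyperplane and the support of `a`: a
  -- generator above such an exponent stays on the hyperplane exactly when it agrees with it on that
  -- support.
  let Φ : Set (Fin n → ℕ) × Set (Fin n) → Set (Fin n → ℝ) := fun q =>
    convexHull ℝ {x | ∃ α ∈ q.1, (∀ i, (α i : ℝ) ≤ x i) ∧ ∀ i ∈ q.2, x i = α i}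
  refine ((hM.powerset.prod (Set.toFinite (univ : Set (Set (Fin n))))).image Φ).subset ?_
  rintro γ ⟨a, l, h⟩
  refine ⟨({α | α ∈ M ∧ a ⬝ᵥ α = l}, {i | a i ≠ 0}), ⟨fun α hα => hα.1, mem_univ _⟩, ?_⟩
  rw [h.eq_convexHull]
  refine congrArg (convexHull ℝ) (Set.ext fun x => ⟨?_, ?_⟩)
  · rintro ⟨α, ⟨hαM, hαl⟩, hle, heq⟩
    refine ⟨⟨α, hαM.1, hle⟩, ?_⟩
    rw [hyperplane, mem_ofPred_eq, ← hαl, ← cast_dotProduct]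
    refine Finset.sum_congr rfl fun i _ => ?_
    by_cases hi : a i = 0
    · simp [hi]
    · rw [heq i hi]
  · rintro ⟨⟨α, hα, hle⟩, hxl⟩
    obtain ⟨β, hβα, hβ⟩ := exists_minimal_le_of_wellFoundedLT
      (fun α => taylorCoeff f α ≠ 0) α hα
    have hβx : ∀ i, (β i : ℝ) ≤ x i := fun i => (Nat.cast_le.2 (hβα i)).trans (hle i)
    have h1 := h.le_weight hβ.1
    have h2 := dotProduct_cast_mono a hβx
    have hxl' : (fun i => (a i : ℝ)) ⬝ᵥ x = l := hxl
    rw [hxl', cast_dotProduct] at h2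
    have h3 : a ⬝ᵥ β = l := le_antisymm (by exact_mod_cast h2) h1
    refine ⟨β, ⟨hβ, h3⟩, hβx, fun i hi => eq_of_dotProduct_eq a hβx ?_ hi⟩
    rw [hxl', cast_dotProduct, h3]

/-- With positive weights the only generators on the hyperplane are exponents of weight `l`, of
which there are finitely many. -/
theorem DefinesFace.isCompact {n : ℕ} {f : (Fin n → ℝ) → ℝ} {γ : Set (Fin n → ℝ)}
    {b : Fin n → ℕ} {l : ℕ} (h : DefinesFace (newtonPolyhedron f) γ b l) (hb : ∀ i, 0 < b i) :
    IsCompact γ := by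
  rw [h.eq_convexHull]
  refine Set.Finite.isCompact_convexHull (𝕜 := ℝ) (((exponentsOfWeight b l).finite_toSet.image
    fun α : Fin n → ℕ => fun i => (α i : ℝ)).subset ?_)
  rintro x ⟨⟨α, hα, hle⟩, hxl⟩
  have hxl' : (fun i => (b i : ℝ)) ⬝ᵥ x = l := hxl
  have h1 := h.le_weight hα
  have h2 := dotProduct_cast_mono b hle
  rw [hxl', cast_dotProduct] at h2
  have h3 : b ⬝ᵥ α = l := le_antisymm (by exact_mod_cast h2) h1
  refine ⟨α, (mem_exponentsOfWeight hb).2 h3, ?_⟩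
  ext i
  refine (eq_of_dotProduct_eq b hle ?_ (hb i).ne').symm
  rw [hxl', cast_dotProduct, h3]

/-- If `a_i = 0`, the face contains a ray in direction `e_i` from each of its points. -/
theorem DefinesFace.pos_of_isCompact {n : ℕ} {f : (Fin n → ℝ) → ℝ} {γ : Set (Fin n → ℝ)}
    {a : Fin n → ℕ} {l : ℕ} (h : DefinesFace (newtonPolyhedron f) γ a l) (hne : γ.Nonempty)
    (hc : IsCompact γ) (i : Fin n) : 0 < a i := by
  by_contra hi
  have hi0 : a i = 0 := by omega
  obtain ⟨x, hx⟩ := hne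
  obtain ⟨C, hC⟩ := hc.isBounded.exists_norm_le
  -- The shift makes the `i`-th coordinate at least `C + 1`, beyond the norm bound `C`.
  have hmem : x + Pi.single i (C + 1 + |x i|) ∈ γ := by
    have hC0 : 0 ≤ C := (norm_nonneg _).trans (hC x hx)
    rw [h.2] at hx ⊢
    refine ⟨add_mem_newtonPolyhedron hx.1 fun k => ?_, ?_⟩
    · rw [Pi.single_apply]
      split_ifs <;> positivity
    · have hxl : (fun i => (a i : ℝ)) ⬝ᵥ x = l := hx.2
      simp [hyperplane, dotProduct_add, hxl, hi0]
  have h1 := (norm_le_pi_norm _ i).trans (hC _ hmem)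
  have h2 : C + 1 ≤ x i + (C + 1 + |x i|) := by linarith [neg_abs_le (x i)]
  simp only [Pi.add_apply, Pi.single_eq_same, Real.norm_eq_abs] at h1
  linarith [le_abs_self (x i + (C + 1 + |x i|))]

/-! ### Toric charts and division by monomials -/

/-- Multiplication of the coordinates with index in `I` by `t`. -/
def scaleOn {n : ℕ} (I : Finset (Fin n)) (t : ℝ) (y : Fin n → ℝ) : Fin n → ℝ :=
  fun j => if j ∈ I then t * y j else y j

theorem prod_scaleOn {n : ℕ} (I : Finset (Fin n)) (t : ℝ) (y : Fin n → ℝ) (e : Fin n → ℕ) :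
    ∏ j, scaleOn I t y j ^ e j = t ^ (∑ j ∈ I, e j) * ∏ j, y j ^ e j := by
  have h : ∀ j, scaleOn I t y j ^ e j = (if j ∈ I then t ^ e j else 1) * y j ^ e j := by
    intro j
    rw [scaleOn]
    split_ifs
    · rw [mul_pow]
    · rw [one_mul]
  simp only [h, Finset.prod_mul_distrib, Finset.prod_ite_mem, Finset.univ_inter,
    Finset.prod_pow_eq_pow_sum]

/-- The link between charts and `γ`-parts: scaling chart coordinates is a weighted scaling of `x`,
with weight the sum of the corresponding skeleton vectors. -/
theorem chart_scaleOn {n : ℕ} (a : Fin n → Fin n → ℕ) (I : Finset (Fin n)) (t : ℝ)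
    (y : Fin n → ℝ) :
    chart a (scaleOn I t y) = fun i => t ^ (∑ j ∈ I, a j i) * chart a y i :=
  funext fun i => prod_scaleOn I t y fun j => a j i

theorem contDiff_chart {n : ℕ} (a : Fin n → Fin n → ℕ) : ContDiff ℝ ∞ (chart a) :=
  contDiff_pi.2 fun _ => contDiff_prod fun k _ => (contDiff_apply ℝ ℝ k).pow _

theorem continuous_scaleOn {n : ℕ} (I : Finset (Fin n)) (y : Fin n → ℝ) :
    Continuous fun t => scaleOn I t y := by
  refine continuous_pi fun j => ?_
  simp only [scaleOn]
  split_ifs <;> fun_prop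

/-- If `f ∘ π = y^e g` with `e_j < l_j` and `f(t^{a^j} x) / t^{l_j}` converges, then `g` vanishes
on `{y_j = 0}`. -/
theorem eq_zero_of_tendsto_scaledQuotient {n : ℕ} {V : Set (Fin n → ℝ)} (hV : IsOpen V)
    {f g : (Fin n → ℝ) → ℝ} {a : Fin n → Fin n → ℕ} {e : Fin n → ℕ} {j : Fin n} {l : ℕ}
    (hlim : ∀ x ∈ V, ∃ c : ℝ, Tendsto (scaledQuotient f (a j) l x) (𝓝[≠] 0) (𝓝 c))
    (hg : ContinuousOn g (chart a ⁻¹' V))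
    (hfg : ∀ y ∈ chart a ⁻¹' V, f (chart a y) = (∏ i, y i ^ e i) * g y)
    (hel : e j < l) {y : Fin n → ℝ} (hy : y ∈ chart a ⁻¹' V) (hyj : y j = 0) : g y = 0 := by
  have hΩ : IsOpen (chart a ⁻¹' V) := hV.preimage (contDiff_chart a).continuous
  -- Generic points of the hyperplane come first, since there the remaining monomial factor can be
  -- cancelled.
  have main : ∀ z ∈ chart a ⁻¹' V, z j = 0 → (∀ i, i ≠ j → z i ≠ 0) → g z = 0 := by
    intro z hz hzj hzi
    have hcont : Continuous fun s : ℝ => Function.update z j s :=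
      continuous_const.update j continuous_id
    have hz0 : Function.update z j 0 = z := by rw [← hzj, Function.update_eq_self]
    have hmem : ∀ᶠ s : ℝ in 𝓝 0, Function.update z j s ∈ chart a ⁻¹' V :=
      (hΩ.preimage hcont).mem_nhds (by simpa only [mem_preimage, hz0] using hz)
    -- The point `z` is approached along the curve with `j`-th coordinate `t * s`; `s ≠ 0` is small
    -- enough for its start `t = 1` to stay in the domain, where `hlim` applies.
    obtain ⟨s, hsΩ, hs0⟩ := ((hmem.filter_mono nhdsWithin_le_nhds).and
      (self_mem_nhdsWithin : ∀ᶠ s : ℝ in 𝓝[≠] 0, s ∈ ({0}ᶜ : Set ℝ))).exists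
    have hscale : ∀ t : ℝ, scaleOn {j} t (Function.update z j s) = Function.update z j (t * s) := by
      intro t
      ext i
      by_cases hij : i = j
      · subst hij; simp [scaleOn]
      · simp [scaleOn, hij]
    have hts : Tendsto (fun t : ℝ => Function.update z j (t * s)) (𝓝[≠] 0) (𝓝 z) := by
      have h : Continuous fun t : ℝ => Function.update z j (t * s) :=
        continuous_const.update j (by fun_prop)
      have := h.tendsto 0
      rw [zero_mul, hz0] at this
      exact this.mono_left nhdsWithin_le_nhds
    obtain ⟨c, hc⟩ := hlim _ hsΩ
    have hpow : Tendsto (fun t : ℝ => t ^ (l - e j)) (𝓝[≠] 0) (𝓝 0) := by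
      have := (continuous_pow (M := ℝ) (l - e j)).tendsto 0
      rw [zero_pow (by omega)] at this
      exact this.mono_left nhdsWithin_le_nhds
    have hzero := hpow.mul hc
    rw [zero_mul] at hzero
    have hprod := ((hg.continuousAt (hΩ.mem_nhds hz)).tendsto.comp hts).const_mul
      (∏ i, Function.update z j s i ^ e i)
    -- The left side tends to 0, as `e j < l` and the quotient converges; the right side tends to a
    -- nonzero multiple of `g z`.
    have heq : (fun t : ℝ => t ^ (l - e j) *
          scaledQuotient f (a j) l (chart a (Function.update z j s)) t) =ᶠ[𝓝[≠] 0]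
        fun t => (∏ i, Function.update z j s i ^ e i) *
          (g ∘ fun t : ℝ => Function.update z j (t * s)) t := by
      filter_upwards [hts.eventually (hΩ.mem_nhds hz), self_mem_nhdsWithin] with t ht ht0
      have ht0' : t ≠ 0 := ht0
      have h1 := chart_scaleOn a {j} t (Function.update z j s)
      simp only [Finset.sum_singleton] at h1
      rw [scaledQuotient, ← h1, hscale, hfg _ ht, ← hscale, prod_scaleOn, Finset.sum_singleton,
        hscale, ← pow_sub_mul_pow t hel.le]
      simp only [Function.comp_apply]
      field_simp
    have h0 := tendsto_nhds_unique (hzero.congr' heq) hprod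
    refine (mul_eq_zero.1 h0.symm).resolve_left (Finset.prod_ne_zero_iff.2 fun i _ => ?_)
    refine pow_ne_zero _ ?_
    by_cases hij : i = j
    · subst hij; simpa using hs0
    · simpa [hij] using hzi i hij
  -- Replacing the other zero coordinates by `ε` gives generic points tending to `y`, and continuity
  -- of `g` concludes.
  let p : ℝ → Fin n → ℝ := fun ε i => if i = j then 0 else if y i = 0 then ε else y i
  have hp : Continuous p := by
    refine continuous_pi fun i => ?_
    simp only [p]
    split_ifs <;> fun_prop
  have hp0 : p 0 = y := by
    ext i
    simp only [p]
    split_ifs with h1 h2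
    · rw [h1, hyj]
    · rw [h2]
    · rfl
  have hpt : Tendsto p (𝓝[≠] 0) (𝓝 y) := by
    have := hp.tendsto 0
    rw [hp0] at this
    exact this.mono_left nhdsWithin_le_nhds
  have h1 := (hg.continuousAt (hΩ.mem_nhds hy)).tendsto.comp hpt
  refine tendsto_nhds_unique h1 (tendsto_const_nhds.congr' ?_)
  filter_upwards [hpt.eventually (hΩ.mem_nhds hy), self_mem_nhdsWithin] with ε hε hε0
  refine (main _ hε (by simp [p]) fun i hi => ?_).symm
  have hε0' : ε ≠ 0 := hε0
  simp only [p, hi, if_false]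
  split_ifs with h2
  · exact hε0'
  · exact h2

/-- The induction runs on the total degree of the monomial already divided out: while it is below `∑
l_j`, some `e_j < l_j` allows division by one more `y_j`. -/
theorem exists_smooth_quotient {n : ℕ} {V : Set (Fin n → ℝ)} (hV : IsOpen V)
    {f : (Fin n → ℝ) → ℝ} (hf : ContDiffOn ℝ ∞ f V) {a : Fin n → Fin n → ℕ} {l : Fin n → ℕ}
    (hlim : ∀ j, ∀ x ∈ V, ∃ c : ℝ, Tendsto (scaledQuotient f (a j) (l j) x) (𝓝[≠] 0) (𝓝 c)) :
    ∃ g : (Fin n → ℝ) → ℝ, ContDiffOn ℝ ∞ g (chart a ⁻¹' V) ∧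
      ∀ y ∈ chart a ⁻¹' V, f (chart a y) = (∏ j, y j ^ l j) * g y := by
  have hΩ : IsOpen (chart a ⁻¹' V) := hV.preimage (contDiff_chart a).continuous
  have key : ∀ N ≤ ∑ j, l j, ∃ e : Fin n → ℕ, (∀ j, e j ≤ l j) ∧ ∑ j, e j = N ∧
      ∃ g : (Fin n → ℝ) → ℝ, ContDiffOn ℝ ∞ g (chart a ⁻¹' V) ∧
        ∀ y ∈ chart a ⁻¹' V, f (chart a y) = (∏ j, y j ^ e j) * g y := by
    intro N hN
    induction N with
    | zero =>
      exact ⟨0, fun _ => Nat.zero_le _, by simp, f ∘ chart a,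
        hf.comp (contDiff_chart a).contDiffOn (fun _ h => h), by simp⟩
    | succ N ih =>
      obtain ⟨e, hel, hsum, g, hg, hfg⟩ := ih (by omega)
      obtain ⟨j, -, hj⟩ := Finset.exists_lt_of_sum_lt
        (show ∑ j, e j < ∑ j, l j by omega)
      obtain ⟨h, hh, hgh⟩ := exists_eq_coord_mul j hΩ hg fun y hy hyj =>
        eq_zero_of_tendsto_scaledQuotient hV (hlim j) hg.continuousOn hfg hj hy hyj
      refine ⟨e + Pi.single j 1, fun i => ?_, ?_, h, hh, fun y hy => ?_⟩
      · by_cases hij : i = j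
        · subst hij; simpa using hj
        · simpa [hij] using hel i
      · simp [Finset.sum_add_distrib, hsum]
      · have hpr : ∏ i, y i ^ (Pi.single j 1 : Fin n → ℕ) i = y j := by
          rw [Finset.prod_eq_single j] <;> simp +contextual
        simp only [Pi.add_apply, pow_add, Finset.prod_mul_distrib]
        rw [hfg y hy, hgh y hy, hpr, mul_assoc]
  obtain ⟨e, hel, hsum, g, hg, hfg⟩ := key _ le_rfl
  have he : e = l := funext fun j =>
    (Finset.sum_eq_sum_iff_of_le fun i _ => hel i).1 hsum j (Finset.mem_univ j)
  exact ⟨g, hg, he ▸ hfg⟩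

/-- The restriction of the quotient `f ∘ π / y^l` to `{y_j = 0, j ∈ I}` is given by a
quasihomogeneous part of `f`. -/
theorem weightPart_chart {n : ℕ} {V : Set (Fin n → ℝ)} (hV : IsOpen V)
    (h0 : (0 : Fin n → ℝ) ∈ V) {f g : (Fin n → ℝ) → ℝ} (hf : ContDiffOn ℝ ∞ f V)
    {a : Fin n → Fin n → ℕ} {l : Fin n → ℕ} (hg : ContinuousOn g (chart a ⁻¹' V))
    (hfg : ∀ y ∈ chart a ⁻¹' V, f (chart a y) = (∏ j, y j ^ l j) * g y)
    (I : Finset (Fin n)) (hb : ∀ i, 0 < ∑ j ∈ I, a j i)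
    (hL : ∀ α, taylorCoeff f α ≠ 0 → ∑ j ∈ I, l j ≤ (fun i => ∑ j ∈ I, a j i) ⬝ᵥ α)
    (y : Fin n → ℝ) :
    weightPart f (fun i => ∑ j ∈ I, a j i) (∑ j ∈ I, l j) (chart a y) =
      (∏ j, y j ^ l j) * g (scaleOn I 0 y) := by
  have hΩ : IsOpen (chart a ⁻¹' V) := hV.preimage (contDiff_chart a).continuous
  -- Positivity of the weight sends this point to the origin, so `y` itself need not lie over `V`.
  have hy0 : scaleOn I 0 y ∈ chart a ⁻¹' V := by
    have : chart a (scaleOn I 0 y) = 0 := by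
      rw [chart_scaleOn]
      ext i
      simp [zero_pow (hb i).ne']
    rw [mem_preimage, this]
    exact h0
  have hs : Tendsto (fun t => scaleOn I t y) (𝓝[≠] 0) (𝓝 (scaleOn I 0 y)) :=
    ((continuous_scaleOn I y).tendsto 0).mono_left nhdsWithin_le_nhds
  have h1 := ((hg.continuousAt (hΩ.mem_nhds hy0)).tendsto.comp hs).const_mul (∏ j, y j ^ l j)
  -- Both sides are limits of the same scaled quotient at `π(y)`: one by Taylor's formula, the other
  -- by the factorization and continuity of `g`.
  refine tendsto_nhds_unique (tendsto_scaledQuotient hV h0 hf hb hL (chart a y)) (h1.congr' ?_)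
  filter_upwards [hs.eventually (hΩ.mem_nhds hy0), self_mem_nhdsWithin] with t ht ht0
  have ht0' : t ≠ 0 := ht0
  rw [scaledQuotient, ← chart_scaleOn, hfg _ ht, prod_scaleOn, mul_assoc,
    mul_div_cancel_left₀ _ (pow_ne_zero _ ht0')]
  rfl

/-! ### The skeleton of a cone of a simplicial subdivision -/

/-- Distinct members of a lattice basis are independent over `ℤ`, so their integer determinant is
nonzero, and remains so over `ℝ`. -/
theorem eq_zero_of_skeleton_basis {n : ℕ} {a : Fin n → Fin n → ℕ} (ha : Function.Injective a)
    {b : Module.Basis (Fin n) ℤ (Fin n → ℤ)}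
    (hab : (range fun (j i : Fin n) => (a j i : ℤ)) ⊆ range b) {v : Fin n → ℝ}
    (hv : ∀ j, (fun i => (a j i : ℝ)) ⬝ᵥ v = 0) : v = 0 := by
  have hab' : ∀ j, ∃ k, b k = fun i => (a j i : ℤ) := fun j => hab ⟨j, rfl⟩
  choose e he using hab'
  have hinj : Function.Injective e := by
    intro j k hjk
    apply ha
    have h := (he j).symm.trans ((congrArg b hjk).trans (he k))
    ext i
    exact_mod_cast congrFun h i
  let A : Matrix (Fin n) (Fin n) ℤ := Matrix.of fun j i => (a j i : ℤ)
  have hdet : A.det ≠ 0 := by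
    intro h
    obtain ⟨w, hw0, hw⟩ := Matrix.exists_vecMul_eq_zero_iff.2 h
    have hli : LinearIndependent ℤ fun j => (fun i => (a j i : ℤ) : Fin n → ℤ) := by
      have := b.linearIndependent.comp e hinj
      rwa [show b ∘ e = fun j => (fun i => (a j i : ℤ) : Fin n → ℤ) from funext he] at this
    refine hw0 (funext (Fintype.linearIndependent_iff.1 hli w ?_))
    rw [← hw]
    ext i
    simp [Matrix.vecMul, dotProduct, A]
  have hdet' : (A.map (Int.castRingHom ℝ)).det ≠ 0 := by
    have := (Int.castRingHom ℝ).map_det A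
    rw [RingHom.mapMatrix_apply] at this
    rw [← this]
    simpa using hdet
  refine Matrix.eq_zero_of_mulVec_eq_zero hdet' (funext fun j => ?_)
  simpa [Matrix.mulVec, dotProduct, A] using hv j

/-- A fixed point `x` of the face `γ` minimizes every covector in `γ^∨`. This is a closed condition
on the covector, so it passes to the closure, which contains `σ`. -/
theorem exists_common_exponent {n m : ℕ} {f : Fin m → (Fin n → ℝ) → ℝ}
    {S : Set (Set (Fin n → ℝ))}
    (hS : IsSimplicialSubdivision S (jointFan fun k => newtonPolyhedron (f k)))
    {σ : Set (Fin n → ℝ)} (hσ : σ ∈ S) {a : Fin n → Fin n → ℕ}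
    (ha : (range fun (j i : Fin n) => (a j i : ℤ)) ⊆ skeleton σ) (k : Fin m) :
    ∃ α : Fin n → ℕ, taylorCoeff (f k) α ≠ 0 ∧ ∀ j, ∀ z ∈ newtonPolyhedron (f k),
      ((a j ⬝ᵥ α : ℕ) : ℝ) ≤ (fun i => (a j i : ℝ)) ⬝ᵥ z := by
  obtain ⟨_, ⟨τ, hτ, rfl⟩, hsub⟩ := hS.subset_cone σ hσ
  obtain ⟨γ, ⟨c₀, l₀, -, hface⟩, ⟨x, hx⟩, hγ⟩ := hτ k
  have hxP : x ∈ newtonPolyhedron (f k) := by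
    rw [hface] at hx
    exact hx.1
  have haσ : ∀ j, (fun i => (a j i : ℝ)) ∈ σ := by
    intro j
    obtain ⟨-, e, ⟨c, l, -, he⟩, -, hj⟩ := ha ⟨j, rfl⟩
    rw [he] at hj
    simpa using hj.1
  have hmin : closure (dualCone (newtonPolyhedron (f k)) γ) ⊆
      {c | ∀ z ∈ newtonPolyhedron (f k), c ⬝ᵥ x ≤ c ⬝ᵥ z} := by
    refine closure_minimal ?_ ?_
    · rintro c ⟨-, hc⟩
      rw [← hc] at hx
      exact hx.2
    · have : {c : Fin n → ℝ | ∀ z ∈ newtonPolyhedron (f k), c ⬝ᵥ x ≤ c ⬝ᵥ z} =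
          ⋂ z ∈ newtonPolyhedron (f k), {c | c ⬝ᵥ x ≤ c ⬝ᵥ z} := by
        ext c; simp
      rw [this]
      refine isClosed_biInter fun z _ => isClosed_le ?_ ?_ <;>
      · simp only [dotProduct]
        fun_prop
  have hax : ∀ j, ∀ z ∈ newtonPolyhedron (f k),
      (fun i => (a j i : ℝ)) ⬝ᵥ x ≤ (fun i => (a j i : ℝ)) ⬝ᵥ z := by
    intro j
    have := mem_iInter.1 (hsub (haσ j)) k
    rw [hγ] at this
    exact hmin this
  -- Passing from the real point `x` to an exponent for all `j` at once: `α` is no worse than `x`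
  -- for the sum of the `a^j` and no better for any single one, so equality holds for each.
  obtain ⟨α, hα, hle⟩ := exists_exponent_le (fun i => ∑ j, a j i) hxP
  have hsum : ∀ z : Fin n → ℝ, (fun i => ((∑ j, a j i : ℕ) : ℝ)) ⬝ᵥ z =
      ∑ j, (fun i => (a j i : ℝ)) ⬝ᵥ z := by
    intro z
    simp only [dotProduct, Nat.cast_sum, Finset.sum_mul]
    exact Finset.sum_comm
  rw [hsum, hsum] at hle
  have hge := fun j => hax j _ (exponent_mem_newtonPolyhedron hα)
  have heq := (Finset.sum_eq_sum_iff_of_le fun j _ => hge j).1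
    (le_antisymm (Finset.sum_le_sum fun j _ => hge j) hle)
  refine ⟨α, hα, fun j z hz => ?_⟩
  rw [← cast_dotProduct, ← heq j (Finset.mem_univ j)]
  exact hax j z hz

/-- An open neighborhood of the origin on which `f_1,…,f_m` admit all the parts for the faces
defined by pairs in `ℤ₊ⁿ × ℤ₊`. -/
theorem exists_open_admitsPart {n m : ℕ} {U : Set (Fin n → ℝ)} (hU : IsOpen U)
    (h0U : (0 : Fin n → ℝ) ∈ U) {f : Fin m → (Fin n → ℝ) → ℝ}
    (hflat : ∀ k, ¬ IsFlat (f k)) (hf : ∀ k, MemEHat U (f k)) :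
    ∃ V : Set (Fin n → ℝ), IsOpen V ∧ (0 : Fin n → ℝ) ∈ V ∧ V ⊆ U ∧
      ((∀ k γ, IsFace (newtonPolyhedron (f k)) γ →
          AdmitsPart (f k) (newtonPolyhedron (f k)) γ U) → V = U) ∧
      ∀ k γ a l, DefinesFace (newtonPolyhedron (f k)) γ a l → ∀ x ∈ V,
        ∃ c : ℝ, Tendsto (scaledQuotient (f k) a l x) (𝓝[≠] 0) (𝓝 c) := by
  -- If all parts exist on `U`, then `V = U` works; otherwise the clause about `V = U` is vacuous
  -- and finitely many neighborhoods are intersected.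
  by_cases hall : ∀ k γ, IsFace (newtonPolyhedron (f k)) γ →
      AdmitsPart (f k) (newtonPolyhedron (f k)) γ U
  · exact ⟨U, hU, h0U, Subset.rfl, fun _ => rfl,
      fun k γ a l h x hx => hall k γ h.isFace a l h x hx⟩
  · have hW : ∀ k γ, ∃ W : Set (Fin n → ℝ), IsOpen W ∧ (0 : Fin n → ℝ) ∈ W ∧
        (IsFace (newtonPolyhedron (f k)) γ → AdmitsPart (f k) (newtonPolyhedron (f k)) γ W) := by
      intro k γ
      by_cases hγ : IsFace (newtonPolyhedron (f k)) γ
      · obtain ⟨W, h1, h2, -, h3⟩ := (hf k).admits (nonempty_iff_ne_empty.2 (hflat k)) γ hγ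
        exact ⟨W, h1, h2, fun _ => h3⟩
      · exact ⟨univ, isOpen_univ, mem_univ _, fun h => absurd h hγ⟩
    choose W hWo hW0 hWa using hW
    refine ⟨U ∩ ⋂ k, ⋂ γ ∈ {γ | ∃ a l, DefinesFace (newtonPolyhedron (f k)) γ a l}, W k γ,
      hU.inter (isOpen_iInter_of_finite fun k =>
        (finite_definesFace (f k)).isOpen_biInter fun γ _ => hWo k γ),
      ⟨h0U, mem_iInter.2 fun k => mem_iInter₂.2 fun γ _ => hW0 k γ⟩, inter_subset_left,
      fun h => absurd h hall, fun k γ a l h x hx => ?_⟩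
    exact hWa k γ h.isFace a l h x (mem_iInter₂.1 (mem_iInter.1 hx.2 k) γ ⟨a, l, h⟩)

/-! ### Nondegeneracy -/

/-- Only exponents lying in `γ` contribute, whichever pair defines it. -/
theorem weightPart_eq_of_definesFace {n : ℕ} {f : (Fin n → ℝ) → ℝ} {γ : Set (Fin n → ℝ)}
    {a b : Fin n → ℕ} {l L : ℕ} (ha : ∀ i, 0 < a i) (hb : ∀ i, 0 < b i)
    (h : DefinesFace (newtonPolyhedron f) γ a l) (h' : DefinesFace (newtonPolyhedron f) γ b L) :
    weightPart f a l = weightPart f b L := by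
  have hiff : ∀ {c : Fin n → ℕ} {r : ℕ}, DefinesFace (newtonPolyhedron f) γ c r →
      ∀ α : Fin n → ℕ, taylorCoeff f α ≠ 0 → (c ⬝ᵥ α = r ↔ (fun i => (α i : ℝ)) ∈ γ) := by
    intro c r hc α hα
    rw [hc.2]
    simp only [mem_inter_iff, exponent_mem_newtonPolyhedron hα, true_and, hyperplane,
      mem_ofPred_eq, cast_dotProduct, Nat.cast_inj]
  ext x
  refine Finset.sum_bij_ne_zero (fun α _ _ => α) ?_ (fun _ _ _ _ _ _ h => h) ?_
    (fun _ _ _ => rfl)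
  · intro α hα hne
    have hc := left_ne_zero_of_mul hne
    rw [mem_exponentsOfWeight ha] at hα
    rwa [mem_exponentsOfWeight hb, hiff h' α hc, ← hiff h α hc]
  · intro α hα hne
    have hc := left_ne_zero_of_mul hne
    rw [mem_exponentsOfWeight hb] at hα
    exact ⟨α, by rwa [mem_exponentsOfWeight ha, hiff h α hc, ← hiff h' α hc], hne, rfl⟩

/-- In logarithmic coordinates `π` is linear: `y_k ∂_k(W ∘ π) = ∑_i a^k_i x_i ∂_i W`. Vanishing for
all `k` gives `x_i ∂_i W = 0` by `hA`, and `x_i ≠ 0`. -/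
theorem hasFDerivAt_comp_chart_eq_zero {n : ℕ} {a : Fin n → Fin n → ℕ}
    (hA : ∀ v : Fin n → ℝ, (∀ j, (fun i => (a j i : ℝ)) ⬝ᵥ v = 0) → v = 0)
    {W : (Fin n → ℝ) → ℝ} {y : Fin n → ℝ} (hy : ∀ i, y i ≠ 0)
    (hW : DifferentiableAt ℝ W (chart a y))
    (h : HasFDerivAt (fun z => W (chart a z)) (0 : (Fin n → ℝ) →L[ℝ] ℝ) y) (i : Fin n) :
    partialDeriv i W (chart a y) = 0 := by
  have hx : ∀ i, chart a y i ≠ 0 := fun i =>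
    Finset.prod_ne_zero_iff.2 fun k _ => pow_ne_zero _ (hy k)
  have hv := hA (fun i => chart a y i * partialDeriv i W (chart a y)) fun k => by
    -- The operator `y_k ∂_k` is the derivative at `t = 1` along the curve `scaleOn {k} t y`.
    have hone : scaleOn {k} 1 y = y := by
      ext j
      simp [scaleOn]
    have hs : HasDerivAt (fun t : ℝ => scaleOn {k} t y) (Pi.single k (y k)) 1 := by
      refine hasDerivAt_pi.2 fun j => ?_
      by_cases hj : j = k
      · subst hj
        simpa [scaleOn] using (hasDerivAt_id (1 : ℝ)).mul_const (y j)
      · simpa [scaleOn, hj] using hasDerivAt_const (1 : ℝ) (y j)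
    have hx' : HasDerivAt (fun t : ℝ => chart a (scaleOn {k} t y))
        (fun i => (a k i : ℝ) * chart a y i) 1 := by
      refine hasDerivAt_pi.2 fun i => ?_
      simpa [chart_scaleOn] using (hasDerivAt_pow (a k i) (1 : ℝ)).mul_const (chart a y i)
    have h1 := HasFDerivAt.comp_hasDerivAt_of_eq 1 h hs hone.symm
    have h2 := HasFDerivAt.comp_hasDerivAt_of_eq 1 hW.hasFDerivAt hx' (by rw [hone])
    have h3 := h2.unique h1
    rw [zero_apply] at h3
    rw [← h3]
    conv_rhs => rw [← Finset.univ_sum_single (fun i => (a k i : ℝ) * chart a y i)]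
    rw [map_sum]
    refine Finset.sum_congr rfl fun i _ => ?_
    rw [← mul_assoc, partialDeriv, ← smul_eq_mul, ← map_smul, ← Pi.single_smul, smul_eq_mul,
      mul_one]
  exact (mul_eq_zero.1 (congrFun hv i)).resolve_left (hx i)

/-- If all the derivatives of `g` along the coordinates outside `I` vanish at `y = z|_{z_I = 0}`,
then `z ↦ g(z|_{z_I = 0})` has derivative zero at `z`. -/
theorem hasFDerivAt_comp_scaleOn_zero {n : ℕ} {g : (Fin n → ℝ) → ℝ} {I : Finset (Fin n)}
    {z : Fin n → ℝ} (hg : DifferentiableAt ℝ g (scaleOn I 0 z))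
    (h : ∀ i ∉ I, partialDeriv i g (scaleOn I 0 z) = 0) :
    HasFDerivAt (fun z => g (scaleOn I 0 z)) (0 : (Fin n → ℝ) →L[ℝ] ℝ) z := by
  let Z : (Fin n → ℝ) →L[ℝ] (Fin n → ℝ) := ContinuousLinearMap.pi fun j =>
    if j ∈ I then 0 else ContinuousLinearMap.proj j
  have hZ : ∀ w, scaleOn I 0 w = Z w := by
    intro w
    ext j
    simp only [scaleOn, Z, ContinuousLinearMap.coe_pi']
    split_ifs <;> simp
  have hZ' : HasFDerivAt (scaleOn I 0) Z z := by
    rw [show scaleOn I 0 = Z from funext hZ]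
    exact Z.hasFDerivAt
  have hc := hg.hasFDerivAt.comp z hZ'
  suffices h0 : (fderiv ℝ g (scaleOn I 0 z)).comp Z = 0 by
    rw [h0] at hc
    exact hc
  refine ContinuousLinearMap.ext fun w => ?_
  rw [zero_apply, ContinuousLinearMap.comp_apply, ← hZ,
    ← Finset.univ_sum_single (scaleOn I 0 w), map_sum]
  refine Finset.sum_eq_zero fun i _ => ?_
  by_cases hi : i ∈ I
  · simp [scaleOn, hi]
  · rw [← mul_one (scaleOn I 0 w i), ← smul_eq_mul, Pi.single_smul, map_smul]
    exact smul_eq_zero_of_right _ (h i hi)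

/-- Weights of exponents, for the sum of a set of covectors with common minimum at `α`. -/
theorem sum_weight_le {n : ℕ} {f : (Fin n → ℝ) → ℝ} {a : Fin n → Fin n → ℕ} {α : Fin n → ℕ}
    (hmin : ∀ j, ∀ z ∈ newtonPolyhedron f,
      ((a j ⬝ᵥ α : ℕ) : ℝ) ≤ (fun i => (a j i : ℝ)) ⬝ᵥ z) (I : Finset (Fin n)) :
    IsValid (newtonPolyhedron f) (fun i => ((∑ j ∈ I, a j i : ℕ) : ℝ))
      ((∑ j ∈ I, a j ⬝ᵥ α : ℕ) : ℝ) := by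
  intro z hz
  have h : (fun i => ((∑ j ∈ I, a j i : ℕ) : ℝ)) ⬝ᵥ z =
      ∑ j ∈ I, (fun i => (a j i : ℝ)) ⬝ᵥ z := by
    simp only [dotProduct, Nat.cast_sum, Finset.sum_mul]
    exact Finset.sum_comm
  rw [h, Nat.cast_sum]
  exact Finset.sum_le_sum fun j _ => hmin j z hz

theorem sum_dotProduct_nat {n : ℕ} (a : Fin n → Fin n → ℕ) (α : Fin n → ℕ)
    (I : Finset (Fin n)) : (fun i => ∑ j ∈ I, a j i) ⬝ᵥ α = ∑ j ∈ I, a j ⬝ᵥ α := by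
  simp only [dotProduct, Finset.sum_mul]
  exact Finset.sum_comm

/-! ### Nonvanishing at the origin and nonsingularity on strata. -/

section Quotient

variable {n : ℕ} {V : Set (Fin n → ℝ)} {f g : (Fin n → ℝ) → ℝ} {a : Fin n → Fin n → ℕ}
  {α : Fin n → ℕ}

/-- At `y = (1,…,1)`, with all coordinates scaled, `weightPart_chart` expresses `g 0` as the sum of
the `c_β` of least total weight. Such a `β` has the same `a^j`-weights as `α` for each `j`, so `β =
α` by `hA`, and `g 0 = c_α`. -/
theorem quotient_zero_ne_zero (hV : IsOpen V) (h0 : (0 : Fin n → ℝ) ∈ V)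
    (hf : ContDiffOn ℝ ∞ f V) (hα : taylorCoeff f α ≠ 0)
    (hmin : ∀ j, ∀ z ∈ newtonPolyhedron f,
      ((a j ⬝ᵥ α : ℕ) : ℝ) ≤ (fun i => (a j i : ℝ)) ⬝ᵥ z)
    (hA : ∀ v : Fin n → ℝ, (∀ j, (fun i => (a j i : ℝ)) ⬝ᵥ v = 0) → v = 0)
    (hg : ContinuousOn g (chart a ⁻¹' V))
    (hfg : ∀ y ∈ chart a ⁻¹' V, f (chart a y) = (∏ j, y j ^ (a j ⬝ᵥ α)) * g y) : g 0 ≠ 0 := by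
  have hb : ∀ i, 0 < ∑ j, a j i := by
    intro i
    by_contra hi
    have hi0 : ∀ j, a j i = 0 := by simpa using hi
    have := congrFun (hA (Pi.single i 1) fun j => by simp [hi0]) i
    simp at this
  have hle : ∀ β : Fin n → ℕ, taylorCoeff f β ≠ 0 → ∀ j, a j ⬝ᵥ α ≤ a j ⬝ᵥ β := by
    intro β hβ j
    have := hmin j _ (exponent_mem_newtonPolyhedron hβ)
    rw [cast_dotProduct] at this
    exact_mod_cast this
  have key := weightPart_chart hV h0 hf hg hfg Finset.univ hb
    (fun β hβ => by
      rw [sum_dotProduct_nat]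
      exact Finset.sum_le_sum fun j _ => hle β hβ j) 1
  have hs : scaleOn Finset.univ 0 (1 : Fin n → ℝ) = 0 := by
    ext; simp [scaleOn]
  have hc : chart a 1 = 1 := by
    ext; simp [chart]
  rw [hs, hc] at key
  have hw : weightPart f (fun i => ∑ j, a j i) (∑ j, a j ⬝ᵥ α) 1 = taylorCoeff f α := by
    rw [weightPart, Finset.sum_eq_single α]
    · simp
    · intro β hβ hne
      rw [mem_exponentsOfWeight hb, sum_dotProduct_nat] at hβ
      by_contra hβ0
      have heq := (Finset.sum_eq_sum_iff_of_le fun j _ =>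
        hle β (left_ne_zero_of_mul hβ0) j).1 hβ.symm
      refine hne ?_
      have hv := hA (fun i => (β i : ℝ) - α i) fun j => by
        have h1 := cast_dotProduct (a j) α
        rw [heq j (Finset.mem_univ j), ← cast_dotProduct] at h1
        simp only [dotProduct, mul_sub, Finset.sum_sub_distrib] at h1 ⊢
        linarith
      ext i
      have := congrFun hv i
      simp only [Pi.zero_apply, sub_eq_zero] at this
      exact_mod_cast this
    · intro h
      exact absurd ((mem_exponentsOfWeight hb).2 (sum_dotProduct_nat a α _)) h
  rw [hw] at key
  intro hg0
  simp [hg0] at key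
  exact hα key

/-- At a singular zero of `g` on the stratum, the product of the monomial and the restricted `g` has
zero derivative. That product is `f_γ ∘ π`, so `∇f_γ` would vanish at a point with nonzero
coordinates. -/
theorem quotient_stratum_nonsingular (hV : IsOpen V) (h0 : (0 : Fin n → ℝ) ∈ V)
    (hf : ContDiffOn ℝ ∞ f V) (hα : taylorCoeff f α ≠ 0)
    (hmin : ∀ j, ∀ z ∈ newtonPolyhedron f,
      ((a j ⬝ᵥ α : ℕ) : ℝ) ≤ (fun i => (a j i : ℝ)) ⬝ᵥ z)
    (hA : ∀ v : Fin n → ℝ, (∀ j, (fun i => (a j i : ℝ)) ⬝ᵥ v = 0) → v = 0)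
    (hg : ContDiffOn ℝ ∞ g (chart a ⁻¹' V))
    (hfg : ∀ y ∈ chart a ⁻¹' V, f (chart a y) = (∏ j, y j ^ (a j ⬝ᵥ α)) * g y)
    (hnd : IsNondegenerate f) {I : Set (Fin n)} (hI : ∀ y ∈ stratum I, chart a y = 0)
    {y : Fin n → ℝ} (hy : y ∈ stratum I) (hgy : g y = 0) :
    ∃ i, i ∉ I ∧ partialDeriv i g y ≠ 0 := by
  classical
  let J : Finset (Fin n) := Finset.univ.filter (· ∈ I)
  have hJ : ∀ j, j ∈ J ↔ j ∈ I := by simp [J]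
  have hb : ∀ i, 0 < ∑ j ∈ J, a j i := by
    intro i
    by_contra hi
    have hi0 : ∀ j ∈ J, a j i = 0 := by simpa using hi
    -- At this test point of the stratum, `x_i = 0` can only come from some `k ∈ I` with `a k i ≠
    -- 0`.
    have h := congrFun (hI (fun j => if j ∈ I then 0 else 1) fun j => by simp) i
    obtain ⟨k, -, hk⟩ := Finset.prod_eq_zero_iff.1 h
    by_cases hkI : k ∈ I
    · simp [hi0 k ((hJ k).2 hkI)] at hk
    · simp [hkI] at hk
  let γ := newtonPolyhedron f ∩
    hyperplane (fun i => ((∑ j ∈ J, a j i : ℕ) : ℝ)) ((∑ j ∈ J, a j ⬝ᵥ α : ℕ) : ℝ)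
  have hγ : DefinesFace (newtonPolyhedron f) γ (fun i => ∑ j ∈ J, a j i)
      (∑ j ∈ J, a j ⬝ᵥ α) := ⟨sum_weight_le hmin J, rfl⟩
  have hne : γ.Nonempty := by
    refine ⟨_, exponent_mem_newtonPolyhedron hα, ?_⟩
    rw [hyperplane, mem_ofPred_eq, cast_dotProduct, sum_dotProduct_nat]
  have hcomp : IsCompact γ := hγ.isCompact hb
  have hW := contDiff_weightPart f (fun i => ∑ j ∈ J, a j i) (∑ j ∈ J, a j ⬝ᵥ α)
  -- Compactness makes every pair defining `γ` positive, so all limits exist on `ℝⁿ` and agree.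
  have hpart : IsPart f (newtonPolyhedron f) γ univ
      (weightPart f (fun i => ∑ j ∈ J, a j i) (∑ j ∈ J, a j ⬝ᵥ α)) := by
    intro c r hc x _
    have hcpos := hc.pos_of_isCompact hne hcomp
    rw [← weightPart_eq_of_definesFace hcpos hb hc hγ]
    exact tendsto_scaledQuotient hV h0 hf hcpos (fun β hβ => hc.le_weight hβ) x
  have key := weightPart_chart hV h0 hf hg.continuousOn hfg J hb fun β hβ => hγ.le_weight hβ
  -- Zero coordinates become 1: `z` lies off all coordinate hyperplanes yet restricts to `y` when
  -- the coordinates in `I` are set to 0.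
  let z : Fin n → ℝ := fun j => if j ∈ I then 1 else y j
  have hz : ∀ j, z j ≠ 0 := by
    intro j
    by_cases hj : j ∈ I
    · simp [z, hj]
    · simpa [z, hj] using fun h => hj ((hy j).1 h)
  have hzy : scaleOn J 0 z = y := by
    ext j
    by_cases hj : j ∈ I
    · simp [scaleOn, hJ, hj, (hy j).2 hj]
    · simp [scaleOn, hJ, hj, z]
  have hyΩ : y ∈ chart a ⁻¹' V := by
    rw [mem_preimage, hI y hy]
    exact h0
  have hΩ : IsOpen (chart a ⁻¹' V) := hV.preimage (contDiff_chart a).continuous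
  by_contra! hcon
  have hgd : DifferentiableAt ℝ g (scaleOn J 0 z) := by
    rw [hzy]
    exact (hg.contDiffAt (hΩ.mem_nhds hyΩ)).differentiableAt (by simp)
  have hder := hasFDerivAt_comp_scaleOn_zero hgd fun i hi => by
    rw [hzy]
    exact hcon i fun h => hi ((hJ i).2 h)
  have hmon : DifferentiableAt ℝ (fun w : Fin n → ℝ => ∏ j, w j ^ (a j ⬝ᵥ α)) z :=
    (contDiff_prod (n := ∞) fun j _ =>
      (contDiff_apply ℝ ℝ j).pow _).differentiable (by simp) z
  have hψ := hmon.hasFDerivAt.mul hder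
  -- Of the two product-rule terms, one vanishes because the restricted derivative does, the other
  -- because `g y = 0`.
  rw [hzy, hgy, smul_zero, zero_smul, add_zero] at hψ
  have hψ' : HasFDerivAt (fun w => weightPart f (fun i => ∑ j ∈ J, a j i)
      (∑ j ∈ J, a j ⬝ᵥ α) (chart a w)) (0 : (Fin n → ℝ) →L[ℝ] ℝ) z := by
    rw [show (fun w => weightPart f (fun i => ∑ j ∈ J, a j i) (∑ j ∈ J, a j ⬝ᵥ α) (chart a w)) =
      _ from funext key]
    exact hψ
  obtain ⟨i, hi⟩ := hnd γ hγ.isFace hne hcomp _ hpart (chart a z) fun i =>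
    Finset.prod_ne_zero_iff.2 fun k _ => pow_ne_zero _ (hz k)
  exact hi (hasFDerivAt_comp_chart_eq_zero hA hz (hW.differentiable (by simp) _) hψ' i)

end Quotient

end NewtonToric

end

theorem theorem7p2 {n m : ℕ} (U : Set (Fin n → ℝ)) (hU : IsOpen U) (h0U : (0 : Fin n → ℝ) ∈ U)
    (f : Fin m → (Fin n → ℝ) → ℝ)
    (hflat : ∀ k, ¬ NewtonToric.IsFlat (f k))
    (hf0 : ∀ k, f k 0 = 0)
    (hdf0 : ∀ k i, NewtonToric.partialDeriv i (f k) 0 = 0)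
    (hf : ∀ k, NewtonToric.MemEHat U (f k)) :
    ∃ V : Set (Fin n → ℝ), IsOpen V ∧ (0 : Fin n → ℝ) ∈ V ∧ V ⊆ U ∧
      ((∀ k γ, NewtonToric.IsFace (NewtonToric.newtonPolyhedron (f k)) γ →
          NewtonToric.AdmitsPart (f k) (NewtonToric.newtonPolyhedron (f k)) γ U) → V = U) ∧
      ∀ S : Set (Set (Fin n → ℝ)),
        NewtonToric.IsSimplicialSubdivision S
          (NewtonToric.jointFan fun k => NewtonToric.newtonPolyhedron (f k)) →
        ∀ σ ∈ S, NewtonToric.dim σ = n →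
        -- `a` is an ordering `a¹(σ),…,aⁿ(σ)` of the skeleton of `σ`
        ∀ a : Fin n → Fin n → ℕ, Function.Injective a →
          (Set.range fun (j i : Fin n) => (a j i : ℤ)) = NewtonToric.skeleton σ →
        ∀ k, ∃ l : Fin n → ℕ,
          -- `l j` is the minimum of `⟨aʲ(σ), ·⟩` over the Newton polyhedron of `f k`
          (∀ j, IsLeast ((fun α : Fin n → ℝ => (fun i => (a j i : ℝ)) ⬝ᵥ α) ''
            NewtonToric.newtonPolyhedron (f k)) (l j : ℝ)) ∧
          ∃ fσ : (Fin n → ℝ) → ℝ,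
            ContDiffOn ℝ ∞ fσ (NewtonToric.chart a ⁻¹' V) ∧
            (0 : Fin n → ℝ) ∈ NewtonToric.chart a ⁻¹' V ∧
            fσ 0 ≠ 0 ∧
            (∀ y ∈ NewtonToric.chart a ⁻¹' V,
              f k (NewtonToric.chart a y) = (∏ j, y j ^ l j) * fσ y) ∧
            (NewtonToric.IsNondegenerate (f k) →
              ∀ I : Set (Fin n), (∀ y ∈ NewtonToric.stratum I, NewtonToric.chart a y = 0) →
                ∀ y ∈ NewtonToric.stratum I, fσ y = 0 →
                  ∃ i, i ∉ I ∧ NewtonToric.partialDeriv i fσ y ≠ 0) := by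

  obtain ⟨V, hV, h0V, hVU, hall, hadm⟩ := NewtonToric.exists_open_admitsPart hU h0U hflat hf
  refine ⟨V, hV, h0V, hVU, hall, fun S hS σ hσ _ a ha hskel k => ?_⟩
  obtain ⟨b, hb⟩ := hS.unimodular σ hσ
  have hA : ∀ v : Fin n → ℝ, (∀ j, (fun i => (a j i : ℝ)) ⬝ᵥ v = 0) → v = 0 := fun v hv =>
    NewtonToric.eq_zero_of_skeleton_basis ha (hskel.subset.trans hb) hv
  obtain ⟨α, hα, hmin⟩ := NewtonToric.exists_common_exponent hS hσ hskel.subset k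
  have hfV : ContDiffOn ℝ ∞ (f k) V := (hf k).smooth.mono hVU
  -- By `hmin` the pair `(a^j, ⟨a^j,α⟩)` is valid, so it defines a face and `hadm` supplies the
  -- limits on `V`.
  obtain ⟨g, hg, hfg⟩ := NewtonToric.exists_smooth_quotient (a := a)
    (l := fun j => a j ⬝ᵥ α) hV hfV fun j x hx => hadm k _ (a j) _ ⟨hmin j, rfl⟩ x hx
  have hpos : ∀ i, ∃ j, a j i ≠ 0 := by
    intro i
    by_contra! hi
    have := congrFun (hA (Pi.single i 1) fun j => by simp [hi]) i
    simp at this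
  refine ⟨fun j => a j ⬝ᵥ α, fun j => ⟨⟨_, NewtonToric.exponent_mem_newtonPolyhedron hα,
    NewtonToric.cast_dotProduct _ _⟩, ?_⟩, g, hg, ?_, ?_, hfg, ?_⟩
  · rintro _ ⟨z, hz, rfl⟩
    exact hmin j z hz
  · have : NewtonToric.chart a 0 = 0 := by
      ext i
      obtain ⟨j, hj⟩ := hpos i
      exact Finset.prod_eq_zero (Finset.mem_univ j) (by simp [hj])
    rw [Set.mem_preimage, this]
    exact h0V
  · exact NewtonToric.quotient_zero_ne_zero hV h0V hfV hα hmin hA hg.continuousOn hfg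
  · intro hnd I hI y hy hgy
    exact NewtonToric.quotient_stratum_nonsingular hV h0V hfV hα hmin hA hg hfg hnd hI hy hgy
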